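/- Let $a,b,c,K$ be real constants with $K\neq 0$. On the open set of points $(\rho,\zeta,t)\in\mathbb R\times\mathbb C\times\mathbb R$ (with $\zeta=x+iy$) satisfying $$\rho>0,\qquad a\rho^2+b\rho+c>0,\qquad b\rho+2c\neq 0,\qquad 1+\tfrac a2|\zeta|^2>0,$$ consider the metric $$g^{a,b,c}=-\frac{K}{4\rho^2}\left(\frac{b\rho+2c}{a\rho^2+b\rho+c}\,d\rho^2+\frac{2(b\rho+2c)\,|d\zeta|^2}{(1+\frac a2|\zeta|^2)^2}+\frac{a\rho^2+b\rho+c}{b\rho+2c}\left(-\frac{dt}{K}+\frac{b\,\mathrm{Im}(\zeta\,d\bar\zeta)}{1+\frac a2|\zeta|^2}\right)^2\right),$$ which is positive definite where $K(b\rho+2c)<0$ and negative definite where $K(b\rho+2c)>0$. (1) If $bc(b^2-4ac)=0$, then $g^{a,b,c}$ is locally symmetric, i.e. its Riemann curvature tensor is parallel for the Levi-Civita connection. (2) If $bc(b^2-4ac)\neq 0$, then $g^{a,b,c}$ is of cohomogeneity exactly $1$: at every point $p$ of the domain, the values at $p$ of the Killing vector fields defined near $p$ form a subspace of codimension exactly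 $1$ of the tangent space. Moreover, in this case there is a transitive locally isometric action on the hypersurfaces of constant $\rho$ of the real Lie algebra $$\mathfrak g=\begin{cases}\mathfrak o(2)\ltimes\mathfrak{heis}_3(\mathbb R)&\text{if }a=0,\\ \mathfrak u(2)&\text{if }a>0,\\ \mathfrak u(1,1)&\text{if }a<0,\end{cases}$$ that is, a homomorphism of Lie algebras from $\mathfrak g$ to the Killing vector fields of $g^{a,b,c}$ on the whole domain whose values at each point span exactly the tangent space of the constant-$\rho$ hypersurface through that point, and which is effective: only $0\in\mathfrak g$ acts by a vector field vanishing identically on some nonempty hypersurface of constant $\rho$. Here $\mathfrak o(2)$ acts on $\mathfrak{heis}_3(\mathbb R)=\mathbb R^2\oplus\mathbb R$, with bracket $[(v,z),(w,s)]=(0,v_1w_2-v_2w_1)$, by $A\cdot(v,z)=(Av,0)$. -/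

import Mathlib

open scoped ContDiff Matrix

noncomputable section

/-! ### Pseudo-Riemannian geometry on open subsets of `ℝⁿ`

A metric is given by its component matrix `g p = (g_ij(p))` in the standard coordinates. -/

namespace CoordGeom

variable {n : ℕ}

/-- The partial derivative `∂_i f` at `p`. -/
def pderiv (i : Fin n) (f : (Fin n → ℝ) → ℝ) (p : Fin n → ℝ) : ℝ :=
  fderiv ℝ f p (Pi.single i 1)

/-- The Christoffel symbol
`Γ^k_ij = 1/2 ∑_l g^kl (∂_i g_jl + ∂_j g_il - ∂_l g_ij)` of the Levi-Civita connection. -/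
def christoffel (g : (Fin n → ℝ) → Matrix (Fin n) (Fin n) ℝ) (k i j : Fin n)
    (p : Fin n → ℝ) : ℝ :=
  1 / 2 * ∑ l, (g p)⁻¹ k l *
    (pderiv i (fun q => g q j l) p + pderiv j (fun q => g q i l) p
      - pderiv l (fun q => g q i j) p)

/-- The components `R^l_kij` of the Riemann curvature tensor, `R(∂_i, ∂_j) ∂_k = ∑_l R^l_kij ∂_l`
with `R(X, Y) = [∇_X, ∇_Y] - ∇_[X, Y]`. -/
def riemann (g : (Fin n → ℝ) → Matrix (Fin n) (Fin n) ℝ) (l k i j : Fin n)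
    (p : Fin n → ℝ) : ℝ :=
  pderiv i (christoffel g l j k) p - pderiv j (christoffel g l i k) p
    + ∑ m, (christoffel g l i m p * christoffel g m j k p
      - christoffel g l j m p * christoffel g m i k p)

/-- The components `∇_m R^l_kij` of the covariant derivative of the curvature tensor. -/
def covDerivRiemann (g : (Fin n → ℝ) → Matrix (Fin n) (Fin n) ℝ) (m l k i j : Fin n)
    (p : Fin n → ℝ) : ℝ :=
  pderiv m (riemann g l k i j) p
    + ∑ s, (christoffel g l m s p * riemann g s k i j p
      - christoffel g s m k p * riemann g l s i j p
      - christoffel g s m i p * riemann g l k s j p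
      - christoffel g s m j p * riemann g l k i s p)

/-- The metric `g` is locally symmetric on the open set `U`: its curvature tensor is parallel. -/
def IsLocallySymmetricOn (g : (Fin n → ℝ) → Matrix (Fin n) (Fin n) ℝ)
    (U : Set (Fin n → ℝ)) : Prop :=
  ∀ p ∈ U, ∀ m l k i j : Fin n, covDerivRiemann g m l k i j p = 0

/-- The components `(L_X g)_ij = ∑_k (X^k ∂_k g_ij + g_kj ∂_i X^k + g_ik ∂_j X^k)` of the Lie
derivative of `g` along the vector field `X`. -/
def lieDerivMetric (g : (Fin n → ℝ) → Matrix (Fin n) (Fin n) ℝ)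
    (X : (Fin n → ℝ) → (Fin n → ℝ)) (i j : Fin n) (p : Fin n → ℝ) : ℝ :=
  ∑ k, (X p k * pderiv k (fun q => g q i j) p
    + g p k j * pderiv i (fun q => X q k) p
    + g p i k * pderiv j (fun q => X q k) p)

/-- `X` is a (smooth) Killing vector field of `g` on the open set `V`. -/
def IsKillingOn (g : (Fin n → ℝ) → Matrix (Fin n) (Fin n) ℝ) (V : Set (Fin n → ℝ))
    (X : (Fin n → ℝ) → (Fin n → ℝ)) : Prop :=
  ContDiffOn ℝ ∞ X V ∧ ∀ p ∈ V, ∀ i j : Fin n, lieDerivMetric g X i j p = 0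

/-- The tangent space at `p` of the orbit of the local isometries of `(U, g)`: the space of the
values at `p` of all Killing fields defined on some open neighbourhood of `p` in `U`. -/
def orbitTangent (g : (Fin n → ℝ) → Matrix (Fin n) (Fin n) ℝ) (U : Set (Fin n → ℝ))
    (p : Fin n → ℝ) : Submodule ℝ (Fin n → ℝ) :=
  Submodule.span ℝ {v | ∃ V : Set (Fin n → ℝ), IsOpen V ∧ V ⊆ U ∧ p ∈ V ∧
    ∃ X : (Fin n → ℝ) → (Fin n → ℝ), IsKillingOn g V X ∧ X p = v}

/-- The cohomogeneity of `(U, g)` at `p`: the codimension of the orbit through `p` of the local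
isometries. -/
def cohomogeneityAt (g : (Fin n → ℝ) → Matrix (Fin n) (Fin n) ℝ) (U : Set (Fin n → ℝ))
    (p : Fin n → ℝ) : ℕ :=
  Module.finrank ℝ ((Fin n → ℝ) ⧸ orbitTangent g U p)

/-- A locally isometric action of the Lie algebra `𝔤` on `(U, g)`, i.e. a Lie algebra homomorphism
`Φ` into the Killing fields of `g` on `U`, that is tangent to the level sets of `f` in `U`,
(infinitesimally) transitive on each of them, and effective on each (nonempty) one of them. -/
structure IsTransitiveKillingActionOnLevels {𝔤 : Type*} [LieRing 𝔤] [LieAlgebra ℝ 𝔤]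
    (g : (Fin n → ℝ) → Matrix (Fin n) (Fin n) ℝ) (U : Set (Fin n → ℝ))
    (f : (Fin n → ℝ) → ℝ) (Φ : 𝔤 →ₗ[ℝ] ((Fin n → ℝ) → (Fin n → ℝ))) : Prop where
  killing : ∀ ξ, IsKillingOn g U (Φ ξ)
  map_lie : ∀ ξ η, ∀ p ∈ U, Φ ⁅ξ, η⁆ p = VectorField.lieBracket ℝ (Φ ξ) (Φ η) p
  tangent : ∀ ξ, ∀ p ∈ U, fderiv ℝ f p (Φ ξ p) = 0
  transitive : ∀ p ∈ U, ∀ v, fderiv ℝ f p v = 0 → ∃ ξ, Φ ξ p = v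
  effective : ∀ p ∈ U, ∀ ξ, (∀ q ∈ U, f q = f p → Φ ξ q = 0) → ξ = 0

end CoordGeom

/-! ### The Lie algebras -/

attribute [local instance 100] LieRing.ofAssociativeRing

/-- The three-dimensional Heisenberg algebra `ℝ² ⊕ ℝ`. -/
@[ext] structure Heis3 where
  /-- the `ℝ²`-component -/
  v : Fin 2 → ℝ
  /-- the central component -/
  z : ℝ

namespace Heis3

/-- The underlying vector space is `ℝ² ⊕ ℝ`. -/
def toProd : Heis3 ≃ (Fin 2 → ℝ) × ℝ where
  toFun x := (x.v, x.z)
  invFun x := ⟨x.1, x.2⟩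
  left_inv _ := rfl
  right_inv _ := rfl

instance : AddCommGroup Heis3 := toProd.addCommGroup

instance : Module ℝ Heis3 := toProd.module ℝ

/-- `[(v, z), (w, s)] = (0, ω(v, w))` with `ω` the standard area form of `ℝ²`. -/
instance : Bracket Heis3 Heis3 :=
  ⟨fun x y => ⟨0, x.v 0 * y.v 1 - x.v 1 * y.v 0⟩⟩

@[simp] theorem bracket_v (x y : Heis3) : ⁅x, y⁆.v = 0 := rfl
@[simp] theorem bracket_z (x y : Heis3) : ⁅x, y⁆.z = x.v 0 * y.v 1 - x.v 1 * y.v 0 := rfl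
@[simp] theorem add_v (x y : Heis3) : (x + y).v = x.v + y.v := rfl
@[simp] theorem add_z (x y : Heis3) : (x + y).z = x.z + y.z := rfl
@[simp] theorem sub_v (x y : Heis3) : (x - y).v = x.v - y.v := rfl
@[simp] theorem sub_z (x y : Heis3) : (x - y).z = x.z - y.z := rfl
@[simp] theorem zero_v : (0 : Heis3).v = 0 := rfl
@[simp] theorem zero_z : (0 : Heis3).z = 0 := rfl
@[simp] theorem smul_v (r : ℝ) (x : Heis3) : (r • x).v = r • x.v := rfl
@[simp] theorem smul_z (r : ℝ) (x : Heis3) : (r • x).z = r * x.z := rfl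

instance : LieRing Heis3 where
  add_lie x y z := by
    apply Heis3.ext
    · simp
    · simp only [bracket_z, add_v, add_z, Pi.add_apply]; ring
  lie_add x y z := by
    apply Heis3.ext
    · simp
    · simp only [bracket_z, add_v, add_z, Pi.add_apply]; ring
  lie_self x := by
    apply Heis3.ext
    · simp
    · simp only [bracket_z, zero_z]; ring
  leibniz_lie x y z := by
    apply Heis3.ext <;> simp

instance : LieAlgebra ℝ Heis3 where
  lie_smul r x y := by
    apply Heis3.ext
    · simp
    · simp only [bracket_z, smul_v, smul_z, Pi.smul_apply, smul_eq_mul]; ring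

/-- A matrix `A ∈ 𝔬(2)` acts on the Heisenberg algebra by the derivation `(v, z) ↦ (A v, 0)`. -/
def rotationDerivation (A : LieAlgebra.Orthogonal.so (Fin 2) ℝ) : LieDerivation ℝ Heis3 Heis3 where
  toFun x := ⟨(A : Matrix (Fin 2) (Fin 2) ℝ) *ᵥ x.v, 0⟩
  map_add' x y := by
    apply Heis3.ext
    · exact Matrix.mulVec_add (A : Matrix (Fin 2) (Fin 2) ℝ) x.v y.v
    · simp
  map_smul' r x := by
    apply Heis3.ext
    · exact Matrix.mulVec_smul (A : Matrix (Fin 2) (Fin 2) ℝ) r x.v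
    · simp
  leibniz' x y := by
    have hA := (LieAlgebra.Orthogonal.mem_so (Fin 2) ℝ _).1 A.2
    have h00 := congrFun (congrFun hA 0) 0
    have h01 := congrFun (congrFun hA 0) 1
    have h11 := congrFun (congrFun hA 1) 1
    simp only [Matrix.transpose_apply, Matrix.neg_apply] at h00 h01 h11
    have k00 : (A : Matrix (Fin 2) (Fin 2) ℝ) 0 0 = 0 := by linarith
    have k11 : (A : Matrix (Fin 2) (Fin 2) ℝ) 1 1 = 0 := by linarith
    apply Heis3.ext
    · simp [-Matrix.mulVec_fin_two]
    · simp [h01, k00, k11]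
      ring

@[simp] theorem rotationDerivation_v (A : LieAlgebra.Orthogonal.so (Fin 2) ℝ) (x : Heis3) :
    (rotationDerivation A x).v = (A : Matrix (Fin 2) (Fin 2) ℝ) *ᵥ x.v := rfl
@[simp] theorem rotationDerivation_z (A : LieAlgebra.Orthogonal.so (Fin 2) ℝ) (x : Heis3) :
    (rotationDerivation A x).z = 0 := rfl

/-- The action of `𝔬(2)` on the Heisenberg algebra by derivations. -/
def rotation : LieAlgebra.Orthogonal.so (Fin 2) ℝ →ₗ⁅ℝ⁆ LieDerivation ℝ Heis3 Heis3 where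
  toFun := rotationDerivation
  map_add' A B := by
    apply LieDerivation.ext
    intro x
    apply Heis3.ext
    · exact Matrix.add_mulVec (A : Matrix (Fin 2) (Fin 2) ℝ) B x.v
    · exact (add_zero (0 : ℝ)).symm
  map_smul' r A := by
    apply LieDerivation.ext
    intro x
    apply Heis3.ext
    · exact Matrix.smul_mulVec r (A : Matrix (Fin 2) (Fin 2) ℝ) x.v
    · exact (mul_zero r).symm
  map_lie' {A B} := by
    apply LieDerivation.ext
    intro x
    rw [LieDerivation.commutator_apply]
    apply Heis3.ext
    · rw [sub_v, rotationDerivation_v, rotationDerivation_v, rotationDerivation_v,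
        rotationDerivation_v, rotationDerivation_v, LieSubalgebra.coe_bracket,
        LieRing.of_associative_ring_bracket, Matrix.sub_mulVec, Matrix.mulVec_mulVec,
        Matrix.mulVec_mulVec]
    · exact (sub_zero (0 : ℝ)).symm

end Heis3

/-- The Lie algebra `𝔬(2) ⋉ 𝔥𝔢𝔦𝔰₃(ℝ)`. -/
abbrev O2Heis3 : Type := LieAlgebra.SemiDirectSum Heis3 (LieAlgebra.Orthogonal.so (Fin 2) ℝ)
  Heis3.rotation

/-- The real Lie algebra of the complex `2 × 2` matrices that are skew with respect to the
sesquilinear form with Gram matrix `J`. -/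
def skewHermitianLie (J : Matrix (Fin 2) (Fin 2) ℂ) :
    LieSubalgebra ℝ (Matrix (Fin 2) (Fin 2) ℂ) where
  carrier := {A | Aᴴ * J + J * A = 0}
  add_mem' {A B} hA hB := by
    simp only [Set.mem_ofPred_eq] at *
    rw [Matrix.conjTranspose_add, Matrix.add_mul, Matrix.mul_add, add_add_add_comm, hA, hB,
      add_zero]
  zero_mem' := by simp
  smul_mem' r A hA := by
    simp only [Set.mem_ofPred_eq] at *
    rw [Matrix.conjTranspose_smul, star_trivial, Matrix.smul_mul, Matrix.mul_smul, ← smul_add, hA,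
      smul_zero]
  lie_mem' {A B} hA hB := by
    have hA' : Aᴴ * J = -(J * A) := eq_neg_of_add_eq_zero_left hA
    have hB' : Bᴴ * J = -(J * B) := eq_neg_of_add_eq_zero_left hB
    change (⁅A, B⁆)ᴴ * J + J * ⁅A, B⁆ = 0
    rw [LieRing.of_associative_ring_bracket, Matrix.conjTranspose_sub, Matrix.conjTranspose_mul,
      Matrix.conjTranspose_mul, Matrix.sub_mul, Matrix.mul_assoc, Matrix.mul_assoc, hA', hB',
      Matrix.mul_neg, Matrix.mul_neg, ← Matrix.mul_assoc, ← Matrix.mul_assoc, hA', hB',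
      Matrix.mul_sub, Matrix.neg_mul, Matrix.neg_mul, Matrix.mul_assoc, Matrix.mul_assoc]
    abel

theorem mem_skewHermitianLie {J A : Matrix (Fin 2) (Fin 2) ℂ} :
    A ∈ skewHermitianLie J ↔ Aᴴ * J + J * A = 0 := Iff.rfl

/-- The Lie algebra `𝔲(2)`. -/
abbrev u2 : LieSubalgebra ℝ (Matrix (Fin 2) (Fin 2) ℂ) := skewHermitianLie 1

/-- The Lie algebra `𝔲(1,1)`. -/
abbrev u11 : LieSubalgebra ℝ (Matrix (Fin 2) (Fin 2) ℂ) :=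
  skewHermitianLie (Matrix.diagonal ![1, -1])

/-! ### The metrics `g^{a,b,c}`

The coordinates are `p = (ρ, x, y, t)`, with `ζ = x + i y`; thus `|ζ|² = x² + y²`,
`|dζ|² = dx² + dy²` and `Im (ζ dζ̄) = y dx - x dy`. -/

/-- The domain of the metric. -/
def abcDomain (a b c : ℝ) : Set (Fin 4 → ℝ) :=
  {p | 0 < p 0 ∧ 0 < a * p 0 ^ 2 + b * p 0 + c ∧ b * p 0 + 2 * c ≠ 0 ∧
    0 < 1 + a / 2 * (p 1 ^ 2 + p 2 ^ 2)}

/-- The 1-form `-dt/K + b Im (ζ dζ̄) / (1 + (a/2)|ζ|²)`. -/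
def abcForm (K a b : ℝ) (p : Fin 4 → ℝ) : Fin 4 → ℝ :=
  ![0, b * p 2 / (1 + a / 2 * (p 1 ^ 2 + p 2 ^ 2)),
    -(b * p 1) / (1 + a / 2 * (p 1 ^ 2 + p 2 ^ 2)), -1 / K]

/-- The metric `g^{a,b,c}`; the two diagonal matrices stand for `dρ²` and `|dζ|²`. -/
def abcMetric (K a b c : ℝ) (p : Fin 4 → ℝ) : Matrix (Fin 4) (Fin 4) ℝ :=
  (-(K / (4 * p 0 ^ 2))) •
    (((b * p 0 + 2 * c) / (a * p 0 ^ 2 + b * p 0 + c)) • Matrix.diagonal ![1, 0, 0, 0]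
      + (2 * (b * p 0 + 2 * c) / (1 + a / 2 * (p 1 ^ 2 + p 2 ^ 2)) ^ 2) •
          Matrix.diagonal ![0, 1, 1, 0]
      + ((a * p 0 ^ 2 + b * p 0 + c) / (b * p 0 + 2 * c)) •
          Matrix.vecMulVec (abcForm K a b p) (abcForm K a b p))

end

/-!
Write the metric as `h₀(ρ) dρ² + h₁(ρ) |dζ|² / D² + h₃(ρ) θ²` with `D = 1 + (a/2)|ζ|²` and `θ` the
connection 1-form. In the coframe `dρ, dx / D, dy / D, θ` the connection and curvature forms are
rational functions of `ρ`, apart from the connection of the base surface. Let `J` be the orthogonal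
almost complex structure that rotates `∂_ρ` into the fibre direction and acts on the base in the
standard way. The curvature tensor turns out to be
`R(X, Y)Z = κ (⟨Y, Z⟩X - ⟨X, Z⟩Y) + μ (⟨JY, Z⟩JX - ⟨JX, Z⟩JY + 2⟨X, JY⟩JZ)`
with `μ = b (b² - 4ac) ρ³ / (K (bρ + 2c)³)` and `κ = 2 / K - μ` (`riemann_abcMetric`).

If `b (b² - 4ac) = 0`, then `μ = 0` and the curvature is constant. If `c = 0`, then `κ = μ = 1 / K`,
and `J` is parallel (`frameJ_parallel`), so that the metric is Kähler of constant holomorphic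
sectional curvature. In both cases the curvature tensor is parallel
(`isLocallySymmetricOn_abcMetric`).

Suppose now `b c (b² - 4ac) ≠ 0`. Let `X` be a local Killing field, `u = dρ(X)` and `τ = θ(X)`. The
components of the Killing equation along the surfaces spanned by `∂_ρ` and `∂_t` are a closed system
for `u` and `τ`. Equality of mixed derivatives gives `∂_t² u = G(ρ) u / K²` for an explicit function
`G`, and then `G' u = 0`. As `G'` is `b c (b² - 4ac)` times a function without zeros, `u = 0`
(`killing_tangent`): all Killing fields are tangent to the hypersurfaces of constant `ρ`.

Conversely, the infinitesimal isometries of the base surface lift to Killing fields, which together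
with `∂_t` form a four-dimensional Lie algebra that is transitive and effective on each of these
hypersurfaces (`killingField`, `isTransitiveKillingActionOnLevels`). Comparing structure constants
identifies it with `𝔬(2) ⋉ 𝔥𝔢𝔦𝔰₃(ℝ)`, `𝔲(2)` or `𝔲(1,1)` (`o2Heis3Param`, `unitaryParam`).
-/

noncomputable section

namespace CoordGeom

variable {n : ℕ}

/-! ### Partial derivatives -/

theorem pderiv_congr {i : Fin n} {f h : (Fin n → ℝ) → ℝ} {U : Set (Fin n → ℝ)} (hU : IsOpen U)
    (hfh : ∀ q ∈ U, f q = h q) {p : Fin n → ℝ} (hp : p ∈ U) : pderiv i f p = pderiv i h p := by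
  unfold pderiv
  rw [Filter.EventuallyEq.fderiv_eq]
  filter_upwards [hU.mem_nhds hp] with q hq using hfh q hq

theorem pderiv_const (i : Fin n) (r : ℝ) (p : Fin n → ℝ) : pderiv i (fun _ => r) p = 0 := by
  simp [pderiv]

theorem pderiv_add {i : Fin n} {f h : (Fin n → ℝ) → ℝ} {p : Fin n → ℝ}
    (hf : DifferentiableAt ℝ f p) (hh : DifferentiableAt ℝ h p) :
    pderiv i (fun q => f q + h q) p = pderiv i f p + pderiv i h p := by
  simp [pderiv, fderiv_fun_add hf hh]

theorem pderiv_sub {i : Fin n} {f h : (Fin n → ℝ) → ℝ} {p : Fin n → ℝ}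
    (hf : DifferentiableAt ℝ f p) (hh : DifferentiableAt ℝ h p) :
    pderiv i (fun q => f q - h q) p = pderiv i f p - pderiv i h p := by
  simp [pderiv, fderiv_fun_sub hf hh]

theorem pderiv_mul {i : Fin n} {f h : (Fin n → ℝ) → ℝ} {p : Fin n → ℝ}
    (hf : DifferentiableAt ℝ f p) (hh : DifferentiableAt ℝ h p) :
    pderiv i (fun q => f q * h q) p = pderiv i f p * h p + f p * pderiv i h p := by
  simp [pderiv, fderiv_fun_mul hf hh]
  ring

theorem pderiv_const_mul {i : Fin n} {f : (Fin n → ℝ) → ℝ} {p : Fin n → ℝ} (r : ℝ)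
    (hf : DifferentiableAt ℝ f p) :
    pderiv i (fun q => r * f q) p = r * pderiv i f p := by
  rw [pderiv_mul (differentiableAt_const r) hf, pderiv_const]
  ring

theorem pderiv_sum {ι : Type*} {s : Finset ι} {i : Fin n} {f : ι → (Fin n → ℝ) → ℝ}
    {p : Fin n → ℝ} (hf : ∀ a ∈ s, DifferentiableAt ℝ (f a) p) :
    pderiv i (fun q => ∑ a ∈ s, f a q) p = ∑ a ∈ s, pderiv i (f a) p := by
  simp [pderiv, fderiv_fun_sum hf]

theorem contDiffOn_pderiv {i : Fin n} {f : (Fin n → ℝ) → ℝ} {U : Set (Fin n → ℝ)}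
    (hU : IsOpen U) (hf : ContDiffOn ℝ ∞ f U) : ContDiffOn ℝ ∞ (pderiv i f) U :=
  (hf.fderiv_of_isOpen hU (m := ∞) le_rfl).clm_apply contDiffOn_const

theorem differentiableAt_of_smooth {f : (Fin n → ℝ) → ℝ} {U : Set (Fin n → ℝ)}
    (hU : IsOpen U) (hf : ContDiffOn ℝ ∞ f U) {p : Fin n → ℝ} (hp : p ∈ U) :
    DifferentiableAt ℝ f p :=
  (hf.contDiffAt (hU.mem_nhds hp)).differentiableAt (by simp)

theorem pderiv_comm {i j : Fin n} {f : (Fin n → ℝ) → ℝ} {U : Set (Fin n → ℝ)}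
    (hU : IsOpen U) (hf : ContDiffOn ℝ ∞ f U) {p : Fin n → ℝ} (hp : p ∈ U) :
    pderiv i (pderiv j f) p = pderiv j (pderiv i f) p := by
  have hd : DifferentiableAt ℝ (fderiv ℝ f) p :=
    ((hf.fderiv_of_isOpen hU (m := ∞) le_rfl).contDiffAt (hU.mem_nhds hp)).differentiableAt
      (by simp)
  have hs : IsSymmSndFDerivAt ℝ f p :=
    (hf.contDiffAt (hU.mem_nhds hp)).isSymmSndFDerivAt (by
      rw [minSmoothness_of_isRCLikeNormedField]
      exact ENat.LEInfty.out)
  have key : ∀ v w, fderiv ℝ (fun q => fderiv ℝ f q v) p w = fderiv ℝ (fderiv ℝ f) p w v := by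
    intro v w
    rw [fderiv_clm_apply hd (differentiableAt_const v)]
    simp
  change fderiv ℝ (fun q => fderiv ℝ f q _) p _ = fderiv ℝ (fun q => fderiv ℝ f q _) p _
  rw [key, key]
  exact hs _ _

/-! ### Matrix-valued functions -/

/-- The entrywise partial derivative `∂_i M` of a matrix-valued function. -/
def mderiv (i : Fin n) (M : (Fin n → ℝ) → Matrix (Fin n) (Fin n) ℝ) (p : Fin n → ℝ) :
    Matrix (Fin n) (Fin n) ℝ :=
  Matrix.of fun a b => pderiv i (fun q => M q a b) p

/-- Entrywise smoothness of a matrix-valued function on `U`. -/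
def MSmoothOn (M : (Fin n → ℝ) → Matrix (Fin n) (Fin n) ℝ) (U : Set (Fin n → ℝ)) : Prop :=
  ∀ a b, ContDiffOn ℝ ∞ (fun q => M q a b) U

theorem MSmoothOn.add {M N : (Fin n → ℝ) → Matrix (Fin n) (Fin n) ℝ} {U : Set (Fin n → ℝ)}
    (hM : MSmoothOn M U) (hN : MSmoothOn N U) : MSmoothOn (fun q => M q + N q) U :=
  fun a b => (hM a b).add (hN a b)

theorem MSmoothOn.mul {M N : (Fin n → ℝ) → Matrix (Fin n) (Fin n) ℝ} {U : Set (Fin n → ℝ)}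
    (hM : MSmoothOn M U) (hN : MSmoothOn N U) : MSmoothOn (fun q => M q * N q) U := by
  intro a b
  simp only [Matrix.mul_apply]
  exact ContDiffOn.sum fun s _ => (hM a s).mul (hN s b)

theorem MSmoothOn.transpose {M : (Fin n → ℝ) → Matrix (Fin n) (Fin n) ℝ} {U : Set (Fin n → ℝ)}
    (hM : MSmoothOn M U) : MSmoothOn (fun q => (M q)ᵀ) U :=
  fun a b => hM b a

theorem MSmoothOn.mderiv {M : (Fin n → ℝ) → Matrix (Fin n) (Fin n) ℝ} {U : Set (Fin n → ℝ)}
    (hU : IsOpen U) (hM : MSmoothOn M U) (i : Fin n) : MSmoothOn (mderiv i M) U :=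
  fun a b => contDiffOn_pderiv hU (hM a b)

section

variable {M N : (Fin n → ℝ) → Matrix (Fin n) (Fin n) ℝ} {U : Set (Fin n → ℝ)} {p : Fin n → ℝ}

theorem MSmoothOn.congr (hM : MSmoothOn M U) (h : ∀ q ∈ U, N q = M q) : MSmoothOn N U :=
  fun a b => (hM a b).congr fun q hq => by rw [h q hq]

theorem mderiv_congr (hU : IsOpen U) (h : ∀ q ∈ U, M q = N q) (hp : p ∈ U) (i : Fin n) :
    mderiv i M p = mderiv i N p := by
  ext a b
  exact pderiv_congr hU (fun q hq => by rw [h q hq]) hp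

theorem mderiv_const (i : Fin n) (C : Matrix (Fin n) (Fin n) ℝ) : mderiv i (fun _ => C) p = 0 := by
  ext a b
  exact pderiv_const i _ p

theorem mderiv_transpose (i : Fin n) : mderiv i (fun q => (M q)ᵀ) p = (mderiv i M p)ᵀ := rfl

theorem mderiv_add (hU : IsOpen U) (hM : MSmoothOn M U) (hN : MSmoothOn N U) (hp : p ∈ U)
    (i : Fin n) : mderiv i (fun q => M q + N q) p = mderiv i M p + mderiv i N p := by
  ext a b
  exact pderiv_add (differentiableAt_of_smooth hU (hM a b) hp)
    (differentiableAt_of_smooth hU (hN a b) hp)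

theorem mderiv_mul (hU : IsOpen U) (hM : MSmoothOn M U) (hN : MSmoothOn N U) (hp : p ∈ U)
    (i : Fin n) :
    mderiv i (fun q => M q * N q) p = mderiv i M p * N p + M p * mderiv i N p := by
  ext a b
  have hM' := fun s => differentiableAt_of_smooth hU (hM a s) hp
  have hN' := fun s => differentiableAt_of_smooth hU (hN s b) hp
  simp only [mderiv, Matrix.of_apply, Matrix.mul_apply, Matrix.add_apply]
  rw [pderiv_sum fun s _ => (hM' s).fun_mul (hN' s), ← Finset.sum_add_distrib]
  exact Finset.sum_congr rfl fun s _ => pderiv_mul (hM' s) (hN' s)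

theorem mderiv_comm (hU : IsOpen U) (hM : MSmoothOn M U) (hp : p ∈ U) (i j : Fin n) :
    mderiv i (mderiv j M) p = mderiv j (mderiv i M) p := by
  ext a b
  exact pderiv_comm hU (hM a b) hp

end

/-! ### The Levi-Civita connection and its curvature in a frame -/

/-- The Christoffel symbols `Γ_i = (Γ^k_ij)_kj` as matrices. -/
def connMatrix (g : (Fin n → ℝ) → Matrix (Fin n) (Fin n) ℝ) (i : Fin n) (p : Fin n → ℝ) :
    Matrix (Fin n) (Fin n) ℝ :=
  Matrix.of fun k j => christoffel g k i j p

/-- The curvature `R(∂_i, ∂_j) = (R^l_kij)_lk` as a matrix. -/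
def curvMatrix (g : (Fin n → ℝ) → Matrix (Fin n) (Fin n) ℝ) (i j : Fin n) (p : Fin n → ℝ) :
    Matrix (Fin n) (Fin n) ℝ :=
  Matrix.of fun l k => riemann g l k i j p

/-- Uniqueness of the Levi-Civita connection: torsion-free metric connection coefficients are the
Christoffel symbols. -/
theorem connMatrix_eq_of_metric_of_symm {g : (Fin n → ℝ) → Matrix (Fin n) (Fin n) ℝ}
    {p : Fin n → ℝ} (hsymm : (g p)ᵀ = g p) (hinv : IsUnit (g p).det)
    (C : Fin n → Matrix (Fin n) (Fin n) ℝ)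
    (hmetric : ∀ i, mderiv i g p = (C i)ᵀ * g p + g p * C i)
    (htorsion : ∀ i j k, C i k j = C j k i) (i : Fin n) : connMatrix g i p = C i := by
  have hs : ∀ s l, g p s l = g p l s := fun s l => congrFun (congrFun hsymm l) s
  have hd : ∀ i j l, pderiv i (fun q => g q j l) p
      = (g p * C i) l j + (g p * C i) j l := by
    intro i j l
    have := congrFun (congrFun (hmetric i) j) l
    simp only [mderiv, Matrix.of_apply, Matrix.add_apply] at this
    rw [this]
    congr 1
    simp only [Matrix.mul_apply, Matrix.transpose_apply]
    exact Finset.sum_congr rfl fun s _ => by rw [hs s l, mul_comm]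
  have ht : ∀ i j l, (g p * C i) l j = (g p * C j) l i := by
    intro i j l
    simp only [Matrix.mul_apply, htorsion i j]
  ext k j
  have : ∀ l, pderiv i (fun q => g q j l) p + pderiv j (fun q => g q i l) p
      - pderiv l (fun q => g q i j) p = 2 * (g p * C i) l j := by
    intro l
    rw [hd, hd, hd, ht j i l, ht i l j, ht j l i]
    ring
  simp only [connMatrix, Matrix.of_apply, christoffel, this]
  have h1 : ((g p)⁻¹ * (g p * C i)) k j = C i k j := by
    rw [Matrix.nonsing_inv_mul_cancel_left _ _ hinv]
  rw [← h1, Matrix.mul_apply, Finset.mul_sum]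
  exact Finset.sum_congr rfl fun l _ => by ring

/-- A moving frame for the metric `g` on the open set `U`, with the connection forms of its
Levi-Civita connection. The rows of `e p` are the components of the coframe, `E` is the inverse of
`e` (its columns are the frame vectors), `η` is the Gram matrix of the frame and `φ i` is the matrix
of connection forms evaluated on `∂_i`. The last two fields say that the connection is metric,
`dη = φᵀ η + η φ`, and torsion-free, `de + φ ∧ e = 0`. -/
structure IsMovingFrame (g : (Fin n → ℝ) → Matrix (Fin n) (Fin n) ℝ) (U : Set (Fin n → ℝ))
    (e E η : (Fin n → ℝ) → Matrix (Fin n) (Fin n) ℝ)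
    (φ : Fin n → (Fin n → ℝ) → Matrix (Fin n) (Fin n) ℝ) : Prop where
  isOpen : IsOpen U
  smooth_coframe : MSmoothOn e U
  smooth_frame : MSmoothOn E U
  smooth_gram : MSmoothOn η U
  smooth_conn : ∀ i, MSmoothOn (φ i) U
  frame_mul_coframe : ∀ p ∈ U, E p * e p = 1
  gram_symm : ∀ p, (η p)ᵀ = η p
  gram_inv : ∀ p ∈ U, IsUnit (η p).det
  metric_eq : ∀ p ∈ U, g p = (e p)ᵀ * η p * e p
  metric : ∀ p ∈ U, ∀ i, mderiv i η p = (φ i p)ᵀ * η p + η p * φ i p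
  torsion : ∀ p ∈ U, ∀ i j a,
    mderiv i e p a j + (φ i p * e p) a j = mderiv j e p a i + (φ j p * e p) a i

namespace IsMovingFrame

variable {g : (Fin n → ℝ) → Matrix (Fin n) (Fin n) ℝ} {U : Set (Fin n → ℝ)}
  {e E η : (Fin n → ℝ) → Matrix (Fin n) (Fin n) ℝ}
  {φ : Fin n → (Fin n → ℝ) → Matrix (Fin n) (Fin n) ℝ} {p : Fin n → ℝ}

theorem coframe_mul_frame (h : IsMovingFrame g U e E η φ) (hp : p ∈ U) : e p * E p = 1 :=
  mul_eq_one_comm.mp (h.frame_mul_coframe p hp)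

theorem smooth_metric (h : IsMovingFrame g U e E η φ) : MSmoothOn g U :=
  ((h.smooth_coframe.transpose.mul h.smooth_gram).mul h.smooth_coframe).congr h.metric_eq

theorem metric_transpose (h : IsMovingFrame g U e E η φ) (hp : p ∈ U) : (g p)ᵀ = g p := by
  rw [h.metric_eq p hp, Matrix.transpose_mul, Matrix.transpose_mul, h.gram_symm,
    Matrix.transpose_transpose, Matrix.mul_assoc]

/-- The Christoffel symbols are the gauge transform of the connection forms. -/
theorem connMatrix_eq (h : IsMovingFrame g U e E η φ) (hp : p ∈ U) (i : Fin n) :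
    connMatrix g i p = E p * (mderiv i e p + φ i p * e p) := by
  have hdet : IsUnit (e p).det := by
    have := congrArg Matrix.det (h.frame_mul_coframe p hp)
    rw [Matrix.det_mul, Matrix.det_one] at this
    exact IsUnit.of_mul_eq_one_right _ this
  refine connMatrix_eq_of_metric_of_symm (h.metric_transpose hp) ?_
    (fun i => E p * (mderiv i e p + φ i p * e p)) ?_ ?_ i
  · rw [h.metric_eq p hp, Matrix.det_mul, Matrix.det_mul, Matrix.det_transpose]
    exact (hdet.mul (h.gram_inv p hp)).mul hdet
  · intro i
    have heC : e p * (E p * (mderiv i e p + φ i p * e p)) = mderiv i e p + φ i p * e p := by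
      rw [← Matrix.mul_assoc, h.coframe_mul_frame hp, Matrix.one_mul]
    have h1 : g p * (E p * (mderiv i e p + φ i p * e p))
        = (e p)ᵀ * η p * (mderiv i e p + φ i p * e p) := by
      rw [h.metric_eq p hp, Matrix.mul_assoc _ (e p), heC]
    have h2 : (E p * (mderiv i e p + φ i p * e p))ᵀ * g p
        = (mderiv i e p + φ i p * e p)ᵀ * η p * e p := by
      rw [h.metric_eq p hp, ← Matrix.mul_assoc, ← Matrix.mul_assoc, ← Matrix.transpose_mul, heC]
    rw [h1, h2, mderiv_congr h.isOpen h.metric_eq hp,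
      mderiv_mul h.isOpen (h.smooth_coframe.transpose.mul h.smooth_gram) h.smooth_coframe hp,
      mderiv_mul h.isOpen h.smooth_coframe.transpose h.smooth_gram hp, mderiv_transpose,
      h.metric p hp, Matrix.transpose_add, Matrix.transpose_mul]
    noncomm_ring
  · intro i j k
    simp only [Matrix.mul_apply (M := E p)]
    exact Finset.sum_congr rfl fun a _ => by
      rw [Matrix.add_apply, Matrix.add_apply, h.torsion p hp i j a]

theorem smooth_connMatrix (h : IsMovingFrame g U e E η φ) (i : Fin n) :
    MSmoothOn (connMatrix g i) U :=
  (h.smooth_frame.mul ((h.smooth_coframe.mderiv h.isOpen i).add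
    ((h.smooth_conn i).mul h.smooth_coframe))).congr fun _ hq => h.connMatrix_eq hq i

theorem coframe_mul_connMatrix (h : IsMovingFrame g U e E η φ) (hp : p ∈ U) (i : Fin n) :
    e p * connMatrix g i p = mderiv i e p + φ i p * e p := by
  rw [h.connMatrix_eq hp, ← Matrix.mul_assoc, h.coframe_mul_frame hp, Matrix.one_mul]

theorem mderiv_coframe (h : IsMovingFrame g U e E η φ) (hp : p ∈ U) (i : Fin n) :
    mderiv i e p = e p * connMatrix g i p - φ i p * e p := by
  rw [h.coframe_mul_connMatrix hp, add_sub_cancel_right]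

/-- The metric is parallel. -/
theorem mderiv_metric (h : IsMovingFrame g U e E η φ) (hp : p ∈ U) (i : Fin n) :
    mderiv i g p = (connMatrix g i p)ᵀ * g p + g p * connMatrix g i p := by
  rw [mderiv_congr h.isOpen h.metric_eq hp,
    mderiv_mul h.isOpen (h.smooth_coframe.transpose.mul h.smooth_gram) h.smooth_coframe hp,
    mderiv_mul h.isOpen h.smooth_coframe.transpose h.smooth_gram hp, mderiv_transpose,
    h.metric p hp, h.mderiv_coframe hp, Matrix.transpose_sub, Matrix.transpose_mul,
    Matrix.transpose_mul, h.metric_eq p hp]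
  noncomm_ring

/-- Cartan's second structure equation. -/
theorem coframe_mul_curvMatrix (h : IsMovingFrame g U e E η φ) (hp : p ∈ U) (i j : Fin n) :
    e p * curvMatrix g i j p =
      (mderiv i (φ j) p - mderiv j (φ i) p + (φ i p * φ j p - φ j p * φ i p)) * e p := by
  have hR : curvMatrix g i j p = mderiv i (connMatrix g j) p - mderiv j (connMatrix g i) p
      + (connMatrix g i p * connMatrix g j p - connMatrix g j p * connMatrix g i p) := by
    ext l k
    simp [curvMatrix, riemann, mderiv, connMatrix, Matrix.mul_apply, Finset.sum_sub_distrib]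
  -- the derivative of `e Γ_j = ∂_j e + φ_j e` in the direction `i`
  have hd : ∀ i j, mderiv i e p * connMatrix g j p + e p * mderiv i (connMatrix g j) p
      = mderiv i (mderiv j e) p + (mderiv i (φ j) p * e p + φ j p * mderiv i e p) := by
    intro i j
    rw [← mderiv_mul h.isOpen h.smooth_coframe (h.smooth_connMatrix j) hp,
      mderiv_congr h.isOpen (fun q hq => h.coframe_mul_connMatrix hq j) hp,
      mderiv_add h.isOpen (h.smooth_coframe.mderiv h.isOpen j)
        ((h.smooth_conn j).mul h.smooth_coframe) hp,
      mderiv_mul h.isOpen (h.smooth_conn j) h.smooth_coframe hp]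
  have h1 := hd i j
  have h2 := hd j i
  rw [mderiv_comm h.isOpen h.smooth_coframe hp j i] at h2
  rw [h.mderiv_coframe hp i] at h1
  rw [h.mderiv_coframe hp j] at h2
  have h3 : e p * mderiv i (connMatrix g j) p - e p * mderiv j (connMatrix g i) p = _ :=
    congrArg₂ (· - ·) (eq_sub_of_add_eq' h1) (eq_sub_of_add_eq' h2)
  rw [hR, mul_add, mul_sub, h3]
  noncomm_ring

end IsMovingFrame

/-! ### Metrics of constant or constant holomorphic sectional curvature are locally symmetric -/

section

variable {Γ P P' Q Q' : Matrix (Fin n) (Fin n) ℝ}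

/-- The product `P^l_i Q_kj` of parallel tensors is parallel; similarly for the two other
positions of the indices below. -/
theorem covDeriv_mul_eq_zero (hP : P' = P * Γ - Γ * P) (hQ : Q' = Γᵀ * Q + Q * Γ)
    (l k i j : Fin n) :
    P' l i * Q k j + P l i * Q' k j
      + ∑ s, (Γ l s * (P s i * Q k j) - Γ s k * (P l i * Q s j) - Γ s i * (P l s * Q k j)
        - Γ s j * (P l i * Q k s)) = 0 := by
  simp only [hP, hQ, Matrix.sub_apply, Matrix.add_apply, Matrix.mul_apply, Matrix.transpose_apply,
    Finset.sum_sub_distrib, sub_mul, mul_add, Finset.sum_mul, Finset.mul_sum]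
  simp only [mul_comm, mul_left_comm]
  ring

theorem covDeriv_mul_eq_zero' (hP : P' = P * Γ - Γ * P) (hQ : Q' = Γᵀ * Q + Q * Γ)
    (l k i j : Fin n) :
    P' l j * Q k i + P l j * Q' k i
      + ∑ s, (Γ l s * (P s j * Q k i) - Γ s k * (P l j * Q s i) - Γ s i * (P l j * Q k s)
        - Γ s j * (P l s * Q k i)) = 0 := by
  rw [← covDeriv_mul_eq_zero hP hQ l k j i]
  congr 1
  exact Finset.sum_congr rfl fun s _ => by ring

theorem covDeriv_mul_eq_zero'' (hP : P' = P * Γ - Γ * P) (hQ : Q' = Γᵀ * Q + Q * Γ)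
    (l k i j : Fin n) :
    P' l k * Q i j + P l k * Q' i j
      + ∑ s, (Γ l s * (P s k * Q i j) - Γ s k * (P l s * Q i j) - Γ s i * (P l k * Q s j)
        - Γ s j * (P l k * Q i s)) = 0 := by
  rw [← covDeriv_mul_eq_zero hP hQ l i k j]
  congr 1
  exact Finset.sum_congr rfl fun s _ => by ring

end

/-- The product rule for the expression of `IsMovingFrame.isLocallySymmetricOn` for the curvature. -/
theorem pderiv_curvature_expr {m : Fin n} {p : Fin n → ℝ} {κ μ c₁ c₂ : ℝ}
    {g₁ g₂ f₁ f₂ f₃ f₄ f₅ f₆ : (Fin n → ℝ) → ℝ}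
    (h₁ : DifferentiableAt ℝ g₁ p) (h₂ : DifferentiableAt ℝ g₂ p)
    (k₁ : DifferentiableAt ℝ f₁ p) (k₂ : DifferentiableAt ℝ f₂ p)
    (k₃ : DifferentiableAt ℝ f₃ p) (k₄ : DifferentiableAt ℝ f₄ p)
    (k₅ : DifferentiableAt ℝ f₅ p) (k₆ : DifferentiableAt ℝ f₆ p) :
    pderiv m (fun q => κ * (c₁ * g₁ q - c₂ * g₂ q)
      + μ * (f₁ q * f₂ q - f₃ q * f₄ q + 2 * (f₅ q * f₆ q))) p =
    κ * (c₁ * pderiv m g₁ p - c₂ * pderiv m g₂ p)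
      + μ * ((pderiv m f₁ p * f₂ p + f₁ p * pderiv m f₂ p)
        - (pderiv m f₃ p * f₄ p + f₃ p * pderiv m f₄ p)
        + 2 * (pderiv m f₅ p * f₆ p + f₅ p * pderiv m f₆ p)) := by
  rw [pderiv_add, pderiv_const_mul, pderiv_sub, pderiv_const_mul, pderiv_const_mul,
    pderiv_const_mul, pderiv_add, pderiv_const_mul, pderiv_sub, pderiv_mul k₁ k₂,
    pderiv_mul k₃ k₄, pderiv_mul k₅ k₆]
  all_goals fun_prop

/-- If the curvature tensor is
`R(X, Y)Z = κ (⟨Y, Z⟩X - ⟨X, Z⟩Y) + μ (⟨JY, Z⟩JX - ⟨JX, Z⟩JY + 2⟨X, JY⟩JZ)`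
with constants `κ`, `μ` and a parallel endomorphism `J`, then it is parallel. With `μ = 0` this
is the case of constant sectional curvature. -/
theorem IsMovingFrame.isLocallySymmetricOn {g : (Fin n → ℝ) → Matrix (Fin n) (Fin n) ℝ}
    {U : Set (Fin n → ℝ)} {e E η : (Fin n → ℝ) → Matrix (Fin n) (Fin n) ℝ}
    {φ : Fin n → (Fin n → ℝ) → Matrix (Fin n) (Fin n) ℝ} (h : IsMovingFrame g U e E η φ)
    {J : (Fin n → ℝ) → Matrix (Fin n) (Fin n) ℝ} (hJs : MSmoothOn J U)
    (hJ : ∀ p ∈ U, ∀ i, mderiv i J p = J p * connMatrix g i p - connMatrix g i p * J p)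
    (κ μ : ℝ)
    (hR : ∀ p ∈ U, ∀ l k i j, riemann g l k i j p =
      κ * ((1 : Matrix (Fin n) (Fin n) ℝ) l i * g p k j
        - (1 : Matrix (Fin n) (Fin n) ℝ) l j * g p k i)
      + μ * (J p l i * (g p * J p) k j - J p l j * (g p * J p) k i
        + 2 * (J p l k * (g p * J p) i j))) :
    IsLocallySymmetricOn g U := by
  intro p hp m l k i j
  have hU := h.isOpen
  have hgs := h.smooth_metric
  have hFs := hgs.mul hJs
  set Γ := connMatrix g m p with hΓ
  have hg' : mderiv m g p = Γᵀ * g p + g p * Γ := h.mderiv_metric hp m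
  have hJ' : mderiv m J p = J p * Γ - Γ * J p := hJ p hp m
  have hF' : mderiv m (fun q => g q * J q) p = Γᵀ * (g p * J p) + g p * J p * Γ := by
    rw [mderiv_mul hU hgs hJs hp, hg', hJ']
    noncomm_ring
  -- the identity is parallel
  have h1' : (0 : Matrix (Fin n) (Fin n) ℝ) = 1 * Γ - Γ * 1 := by simp
  have dg := fun a b => differentiableAt_of_smooth hU (hgs a b) hp
  have dJ := fun a b => differentiableAt_of_smooth hU (hJs a b) hp
  have dF := fun a b => differentiableAt_of_smooth hU (hFs a b) hp
  have hd : pderiv m (riemann g l k i j) p =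
      κ * ((1 : Matrix (Fin n) (Fin n) ℝ) l i * mderiv m g p k j
        - (1 : Matrix (Fin n) (Fin n) ℝ) l j * mderiv m g p k i)
      + μ * ((mderiv m J p l i * (g p * J p) k j
          + J p l i * mderiv m (fun q => g q * J q) p k j)
        - (mderiv m J p l j * (g p * J p) k i
          + J p l j * mderiv m (fun q => g q * J q) p k i)
        + 2 * (mderiv m J p l k * (g p * J p) i j
          + J p l k * mderiv m (fun q => g q * J q) p i j)) := by
    rw [pderiv_congr hU (fun q hq => hR q hq l k i j) hp]
    exact pderiv_curvature_expr (dg _ _) (dg _ _) (dJ _ _) (dF _ _) (dJ _ _) (dF _ _) (dJ _ _)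
      (dF _ _)
  have a1 := covDeriv_mul_eq_zero h1' hg' l k i j
  have a2 := covDeriv_mul_eq_zero' h1' hg' l k i j
  have a3 := covDeriv_mul_eq_zero hJ' hF' l k i j
  have a4 := covDeriv_mul_eq_zero' hJ' hF' l k i j
  have a5 := covDeriv_mul_eq_zero'' hJ' hF' l k i j
  have hc : ∀ a b, christoffel g a m b p = Γ a b := fun a b => rfl
  rw [covDerivRiemann, hd]
  have hs : ∀ f1 f2 f3 f4 f5 : Fin n → ℝ,
      ∑ s, (κ * (f1 s - f2 s) + μ * (f3 s - f4 s + 2 * f5 s))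
        = κ * (∑ s, f1 s - ∑ s, f2 s) + μ * (∑ s, f3 s - ∑ s, f4 s + 2 * ∑ s, f5 s) := by
    intro f1 f2 f3 f4 f5
    simp only [Finset.sum_add_distrib, Finset.sum_sub_distrib, ← Finset.mul_sum]
  have hsum : ∑ s, (Γ l s * riemann g s k i j p - Γ s k * riemann g l s i j p
      - Γ s i * riemann g l k s j p - Γ s j * riemann g l k i s p) = _ :=
    Eq.trans (Finset.sum_congr rfl fun s _ => ?_) (hs
    (fun s => Γ l s * ((1 : Matrix (Fin n) (Fin n) ℝ) s i * g p k j)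
      - Γ s k * ((1 : Matrix (Fin n) (Fin n) ℝ) l i * g p s j)
      - Γ s i * ((1 : Matrix (Fin n) (Fin n) ℝ) l s * g p k j)
      - Γ s j * ((1 : Matrix (Fin n) (Fin n) ℝ) l i * g p k s))
    (fun s => Γ l s * ((1 : Matrix (Fin n) (Fin n) ℝ) s j * g p k i)
      - Γ s k * ((1 : Matrix (Fin n) (Fin n) ℝ) l j * g p s i)
      - Γ s i * ((1 : Matrix (Fin n) (Fin n) ℝ) l j * g p k s)
      - Γ s j * ((1 : Matrix (Fin n) (Fin n) ℝ) l s * g p k i))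
    (fun s => Γ l s * (J p s i * (g p * J p) k j) - Γ s k * (J p l i * (g p * J p) s j)
      - Γ s i * (J p l s * (g p * J p) k j) - Γ s j * (J p l i * (g p * J p) k s))
    (fun s => Γ l s * (J p s j * (g p * J p) k i) - Γ s k * (J p l j * (g p * J p) s i)
      - Γ s i * (J p l j * (g p * J p) k s) - Γ s j * (J p l s * (g p * J p) k i))
    (fun s => Γ l s * (J p s k * (g p * J p) i j) - Γ s k * (J p l s * (g p * J p) i j)
      - Γ s i * (J p l k * (g p * J p) s j) - Γ s j * (J p l k * (g p * J p) i s)))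
  · simp only [hc, hsum]
    simp only [Matrix.zero_apply] at a1 a2
    linear_combination κ * a1 - κ * a2 + μ * a3 - μ * a4 + 2 * μ * a5
  · simp only [hR p hp]
    ring

/-! ### Curvature in terms of frame components -/

/-- The endomorphism `κ (⟨v, ·⟩u - ⟨u, ·⟩v) + μ (⟨Jv, ·⟩Ju - ⟨Ju, ·⟩Jv + 2⟨u, Jv⟩J)`, where
`⟨·, ·⟩` is given by the Gram matrix `η`. -/
def curvOp (η J : Matrix (Fin n) (Fin n) ℝ) (κ μ : ℝ) (u v : Fin n → ℝ) :
    Matrix (Fin n) (Fin n) ℝ :=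
  κ • (Matrix.vecMulVec u (η *ᵥ v) - Matrix.vecMulVec v (η *ᵥ u))
    + μ • (Matrix.vecMulVec (J *ᵥ u) ((η * J) *ᵥ v) - Matrix.vecMulVec (J *ᵥ v) ((η * J) *ᵥ u)
      + (2 * (u ⬝ᵥ (η * J) *ᵥ v)) • J)

section

variable {η J : Matrix (Fin n) (Fin n) ℝ} {κ μ : ℝ}

theorem curvOp_add_right (u v w : Fin n → ℝ) :
    curvOp η J κ μ u (v + w) = curvOp η J κ μ u v + curvOp η J κ μ u w := by
  simp only [curvOp, Matrix.mulVec_add, Matrix.vecMulVec_add, Matrix.add_vecMulVec,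
    dotProduct_add, mul_add, add_smul]
  module

theorem curvOp_smul_right (r : ℝ) (u v : Fin n → ℝ) :
    curvOp η J κ μ u (r • v) = r • curvOp η J κ μ u v := by
  simp only [curvOp, Matrix.mulVec_smul, Matrix.vecMulVec_smul, Matrix.smul_vecMulVec,
    dotProduct_smul, smul_eq_mul]
  module

theorem curvOp_swap (hF : (η * J)ᵀ = -(η * J)) (u v : Fin n → ℝ) :
    curvOp η J κ μ v u = -curvOp η J κ μ u v := by
  have : v ⬝ᵥ (η * J) *ᵥ u = -(u ⬝ᵥ (η * J) *ᵥ v) := by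
    rw [Matrix.dotProduct_mulVec, ← Matrix.mulVec_transpose, hF, Matrix.neg_mulVec,
      neg_dotProduct, dotProduct_comm]
  simp only [curvOp, this]
  module

theorem curvOp_self (hF : (η * J)ᵀ = -(η * J)) (u : Fin n → ℝ) : curvOp η J κ μ u u = 0 := by
  ext a b
  have := congrFun (congrFun (curvOp_swap (κ := κ) (μ := μ) hF u u) a) b
  rw [Matrix.neg_apply] at this
  rw [Matrix.zero_apply]
  linarith

end

namespace IsMovingFrame

variable {g : (Fin n → ℝ) → Matrix (Fin n) (Fin n) ℝ} {U : Set (Fin n → ℝ)}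
  {e E η : (Fin n → ℝ) → Matrix (Fin n) (Fin n) ℝ}
  {φ : Fin n → (Fin n → ℝ) → Matrix (Fin n) (Fin n) ℝ} {p : Fin n → ℝ}

/-- If the curvature forms of the frame are given by `curvOp`, then so is the curvature tensor in
coordinates, with `J` replaced by its coordinate components `E J e`. -/
theorem riemann_eq (h : IsMovingFrame g U e E η φ) (hp : p ∈ U)
    {J : Matrix (Fin n) (Fin n) ℝ} {κ μ : ℝ}
    (hΩ : ∀ i j, mderiv i (φ j) p - mderiv j (φ i) p + (φ i p * φ j p - φ j p * φ i p)
      = curvOp (η p) J κ μ ((e p).col i) ((e p).col j)) (l k i j : Fin n) :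
    riemann g l k i j p =
      κ * ((1 : Matrix (Fin n) (Fin n) ℝ) l i * g p k j
        - (1 : Matrix (Fin n) (Fin n) ℝ) l j * g p k i)
      + μ * ((E p * J * e p) l i * (g p * (E p * J * e p)) k j
        - (E p * J * e p) l j * (g p * (E p * J * e p)) k i
        + 2 * ((E p * J * e p) l k * (g p * (E p * J * e p)) i j)) := by
  have hEe := h.frame_mul_coframe p hp
  have h1 : curvMatrix g i j p
      = E p * curvOp (η p) J κ μ ((e p).col i) ((e p).col j) * e p := by
    rw [← hΩ, Matrix.mul_assoc, ← h.coframe_mul_curvMatrix hp, ← Matrix.mul_assoc, hEe,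
      Matrix.one_mul]
  have hgJ : g p * (E p * J * e p) = (e p)ᵀ * (η p * J) * e p := by
    rw [h.metric_eq p hp, Matrix.mul_assoc, Matrix.mul_assoc (E p), ← Matrix.mul_assoc (e p),
      h.coframe_mul_frame hp, Matrix.one_mul]
    simp only [Matrix.mul_assoc]
  -- the components of `u ⊗ S v`, `u` and `v` columns of `e`, in the coordinate basis
  have hv : ∀ (R S : Matrix (Fin n) (Fin n) ℝ) (i j l k : Fin n),
      (E p * Matrix.vecMulVec (R *ᵥ (e p).col i) (S *ᵥ (e p).col j) * e p) l k
        = (E p * R * e p) l i * ((e p)ᵀ * S * e p) k j := by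
    intro R S i j l k
    rw [Matrix.mul_vecMulVec, Matrix.vecMulVec_mul, Matrix.vecMulVec_apply, Matrix.mul_assoc,
      Matrix.mul_assoc, ← Matrix.mulVec_transpose]
    rfl
  have hv1 : ∀ i j l k : Fin n,
      (E p * Matrix.vecMulVec ((e p).col i) (η p *ᵥ (e p).col j) * e p) l k
        = (1 : Matrix (Fin n) (Fin n) ℝ) l i * g p k j := by
    intro i j l k
    have := hv 1 (η p) i j l k
    rwa [Matrix.one_mulVec, Matrix.mul_one, hEe, ← h.metric_eq p hp] at this
  have hd : (e p).col i ⬝ᵥ (η p * J) *ᵥ (e p).col j = ((e p)ᵀ * (η p * J) * e p) i j := by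
    rw [Matrix.mul_assoc]
    rfl
  have h2 : riemann g l k i j p = curvMatrix g i j p l k := rfl
  rw [h2, h1, curvOp, hgJ, hd]
  simp only [mul_add, mul_sub, add_mul, sub_mul, Matrix.mul_smul, Matrix.smul_mul,
    Matrix.add_apply, Matrix.sub_apply, Matrix.smul_apply, smul_eq_mul, hv, hv1]
  ring

/-- An endomorphism that is parallel with respect to the connection forms of the frame is parallel
in coordinates. -/
theorem mderiv_endomorphism (h : IsMovingFrame g U e E η φ) (hp : p ∈ U)
    {J : (Fin n → ℝ) → Matrix (Fin n) (Fin n) ℝ} (hJs : MSmoothOn J U) (i : Fin n)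
    (hJ : mderiv i J p + (φ i p * J p - J p * φ i p) = 0) :
    mderiv i (fun q => E q * J q * e q) p
      = E p * J p * e p * connMatrix g i p - connMatrix g i p * (E p * J p * e p) := by
  have hs : MSmoothOn (fun q => E q * J q * e q) U :=
    (h.smooth_frame.mul hJs).mul h.smooth_coframe
  have he : ∀ q ∈ U, e q * (E q * J q * e q) = J q * e q := fun q hq => by
    rw [Matrix.mul_assoc, ← Matrix.mul_assoc (e q), h.coframe_mul_frame hq, Matrix.one_mul]
  have h1 := mderiv_congr h.isOpen he hp i
  rw [mderiv_mul h.isOpen h.smooth_coframe hs hp, mderiv_mul h.isOpen hJs h.smooth_coframe hp,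
    h.mderiv_coframe hp, eq_neg_of_add_eq_zero_left hJ] at h1
  have h2 : e p * mderiv i (fun q => E q * J q * e q) p
      = J p * (e p * connMatrix g i p) - e p * connMatrix g i p * (E p * J p * e p) := by
    rw [← sub_eq_zero] at h1 ⊢
    rw [← h1, sub_mul, Matrix.mul_assoc (φ i p), he p hp]
    noncomm_ring
  have h3 := congrArg (fun M => E p * M) h2
  simp only [← Matrix.mul_assoc, mul_sub, h.frame_mul_coframe p hp, Matrix.one_mul] at h3
  simpa only [Matrix.mul_assoc] using h3

end IsMovingFrame

end CoordGeom

/-! ### The adapted coframe of the metrics `g^{a,b,c}` and its connection forms -/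

namespace AbcMetric

open CoordGeom

variable (K a b c : ℝ)

/-- The coefficient `h₀` of `dρ²` in the metric, as a function of `ρ`. -/
def radialCoeff (r : ℝ) : ℝ :=
  -(K / (4 * r ^ 2)) * ((b * r + 2 * c) / (a * r ^ 2 + b * r + c))

/-- The coefficient `h₁` of `|dζ|² / (1 + (a/2)|ζ|²)²` in the metric. -/
def baseCoeff (r : ℝ) : ℝ := -(K / (4 * r ^ 2)) * (2 * (b * r + 2 * c))

/-- The coefficient `h₃` of the square of the connection 1-form in the metric. -/
def fibreCoeff (r : ℝ) : ℝ :=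
  -(K / (4 * r ^ 2)) * ((a * r ^ 2 + b * r + c) / (b * r + 2 * c))

/-- The factor `1 + (a/2)|ζ|²`. -/
def conf (p : Fin 4 → ℝ) : ℝ := 1 + a / 2 * (p 1 ^ 2 + p 2 ^ 2)

/-- The coframe `dρ, dx / D, dy / D, θ`, where `D = 1 + (a/2)|ζ|²` and `θ` is the connection
1-form `abcForm`. -/
def coframe (p : Fin 4 → ℝ) : Matrix (Fin 4) (Fin 4) ℝ :=
  !![1, 0, 0, 0; 0, 1 / conf a p, 0, 0; 0, 0, 1 / conf a p, 0;
    0, b * p 2 / conf a p, -(b * p 1) / conf a p, -1 / K]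

/-- The dual frame, in columns. -/
def frame (p : Fin 4 → ℝ) : Matrix (Fin 4) (Fin 4) ℝ :=
  !![1, 0, 0, 0; 0, conf a p, 0, 0; 0, 0, conf a p, 0; 0, K * b * p 2, -(K * b * p 1), -K]

/-- The Gram matrix of the frame. -/
def gram (p : Fin 4 → ℝ) : Matrix (Fin 4) (Fin 4) ℝ :=
  Matrix.diagonal ![radialCoeff K a b c (p 0), baseCoeff K b c (p 0), baseCoeff K b c (p 0),
    fibreCoeff K a b c (p 0)]

/-- Half the logarithmic derivative of `radialCoeff`. -/
def radialLogDeriv (r : ℝ) : ℝ :=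
  (b / (b * r + 2 * c) - (2 * a * r + b) / (a * r ^ 2 + b * r + c) - 2 / r) / 2

/-- Half the logarithmic derivative of `baseCoeff`. -/
def baseLogDeriv (r : ℝ) : ℝ := (b / (b * r + 2 * c) - 2 / r) / 2

/-- Half the logarithmic derivative of `fibreCoeff`. -/
def fibreLogDeriv (r : ℝ) : ℝ :=
  ((2 * a * r + b) / (a * r ^ 2 + b * r + c) - b / (b * r + 2 * c) - 2 / r) / 2

/-- `b h₃ / h₁`, which measures the twisting of the fibres of `∂_t`. -/
def twist (r : ℝ) : ℝ := b * (a * r ^ 2 + b * r + c) / (2 * (b * r + 2 * c) ^ 2)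

/-- `h₁' / (2 h₀)`. -/
def baseCurv (r : ℝ) : ℝ := 2 * (a * r ^ 2 + b * r + c) * baseLogDeriv b c r

/-- `h₃' / (2 h₀)`. -/
def fibreCurv (r : ℝ) : ℝ :=
  (a * r ^ 2 + b * r + c) ^ 2 / (b * r + 2 * c) ^ 2 * fibreLogDeriv a b c r

/-- The components of the Levi-Civita connection along the vector fields of the frame, up to the
connection of the base surface. -/
def connCoeff (r : ℝ) : Fin 4 → Matrix (Fin 4) (Fin 4) ℝ
  | 0 => Matrix.diagonal ![radialLogDeriv a b c r, baseLogDeriv b c r, baseLogDeriv b c r,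
      fibreLogDeriv a b c r]
  | 1 => !![0, -baseCurv a b c r, 0, 0; baseLogDeriv b c r, 0, 0, 0; 0, 0, 0, -twist a b c r;
      0, 0, b, 0]
  | 2 => !![0, 0, -baseCurv a b c r, 0; 0, 0, 0, twist a b c r; baseLogDeriv b c r, 0, 0, 0;
      0, -b, 0, 0]
  | 3 => !![0, 0, 0, -fibreCurv a b c r; 0, 0, twist a b c r, 0; 0, -twist a b c r, 0, 0;
      fibreLogDeriv a b c r, 0, 0, 0]

/-- The infinitesimal rotation of the base directions. -/
def baseRot : Matrix (Fin 4) (Fin 4) ℝ := !![0, 0, 0, 0; 0, 0, 1, 0; 0, -1, 0, 0; 0, 0, 0, 0]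

/-- The correction `b W₃ - a R` to the horizontal connection matrices, with `W₃` the connection
along the fibres and `R` the rotation of the base directions; it comes from the horizontal
components of `θ` and from the connection of the base surface. -/
def horizCorr (r : ℝ) : Matrix (Fin 4) (Fin 4) ℝ := b • connCoeff a b c r 3 - a • baseRot

/-- The connection matrices of the frame, evaluated on the coordinate vector fields. -/
def conn : Fin 4 → (Fin 4 → ℝ) → Matrix (Fin 4) (Fin 4) ℝ
  | 0 => fun p => connCoeff a b c (p 0) 0
  | 1 => fun p =>
    (conf a p)⁻¹ • (connCoeff a b c (p 0) 1 + p 1 • 0 + p 2 • horizCorr a b c (p 0))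
  | 2 => fun p =>
    (conf a p)⁻¹ • (connCoeff a b c (p 0) 2 + p 1 • (-horizCorr a b c (p 0)) + p 2 • 0)
  | 3 => fun p => (-1 / K) • connCoeff a b c (p 0) 3

variable {K a b c}

theorem isOpen_abcDomain : IsOpen (abcDomain a b c) := by
  have h1 : IsOpen {p : Fin 4 → ℝ | 0 < p 0} :=
    isOpen_lt continuous_const (by fun_prop)
  have h2 : IsOpen {p : Fin 4 → ℝ | 0 < a * p 0 ^ 2 + b * p 0 + c} :=
    isOpen_lt continuous_const (by fun_prop)
  have h3 : IsOpen {p : Fin 4 → ℝ | b * p 0 + 2 * c ≠ 0} :=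
    isOpen_ne_fun (by fun_prop) continuous_const
  have h4 : IsOpen {p : Fin 4 → ℝ | 0 < 1 + a / 2 * (p 1 ^ 2 + p 2 ^ 2)} :=
    isOpen_lt continuous_const (by fun_prop)
  exact h1.inter (h2.inter (h3.inter h4))

theorem conf_ne_zero {p : Fin 4 → ℝ} (hp : p ∈ abcDomain a b c) : conf a p ≠ 0 := hp.2.2.2.ne'

theorem abcMetric_eq (p : Fin 4 → ℝ) : abcMetric K a b c p
    = (coframe K a b p)ᵀ * gram K a b c p * coframe K a b p := by
  have hD : 1 + a / 2 * (p 1 ^ 2 + p 2 ^ 2) = conf a p := rfl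
  ext i j
  fin_cases i <;> fin_cases j <;>
    simp [abcMetric, coframe, gram, abcForm, Matrix.mul_apply, Fin.sum_univ_four,
      Matrix.diagonal_apply, radialCoeff, baseCoeff, fibreCoeff, hD] <;>
    ring

theorem frame_mul_coframe (hK : K ≠ 0) {p : Fin 4 → ℝ} (hp : p ∈ abcDomain a b c) :
    frame K a b p * coframe K a b p = 1 := by
  have hD := conf_ne_zero hp
  ext i j
  fin_cases i <;> fin_cases j <;>
    simp [coframe, frame, Matrix.mul_apply, Fin.sum_univ_four, hD] <;>
    field_simp <;> ring

/-! ### Derivatives of the structure functions -/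

section Radial

variable {r : ℝ}

variable (a b c) in
theorem hasDerivAt_quadratic (r : ℝ) :
    HasDerivAt (fun r : ℝ => a * r ^ 2 + b * r + c) (2 * a * r + b) r := by
  refine ((((hasDerivAt_id r).pow 2).const_mul a).add ((hasDerivAt_id r).const_mul b)
    |>.add_const c).congr_deriv ?_
  simp
  ring

variable (b c) in
theorem hasDerivAt_linear (r : ℝ) : HasDerivAt (fun r : ℝ => b * r + 2 * c) b r := by
  simpa using ((hasDerivAt_id r).const_mul b).add_const (2 * c)

variable (K) in
theorem hasDerivAt_prefactor (h0 : r ≠ 0) :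
    HasDerivAt (fun r : ℝ => -(K / (4 * r ^ 2))) (K / (2 * r ^ 3)) r := by
  refine (((hasDerivAt_const r K).div (((hasDerivAt_id r).pow 2).const_mul 4) ?_).neg).congr_deriv ?_
  · simpa using h0
  · simp
    field_simp
    ring

theorem hasDerivAt_radialCoeff (h0 : r ≠ 0) (hA : a * r ^ 2 + b * r + c ≠ 0)
    (hB : b * r + 2 * c ≠ 0) : HasDerivAt (radialCoeff K a b c)
    (2 * radialLogDeriv a b c r * radialCoeff K a b c r) r := by
  refine ((hasDerivAt_prefactor K h0).mul
    ((hasDerivAt_linear b c r).div (hasDerivAt_quadratic a b c r) hA)).congr_deriv ?_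
  simp only [radialLogDeriv, radialCoeff, Pi.div_apply]
  generalize a * r ^ 2 + b * r + c = A at hA ⊢
  generalize b * r + 2 * c = B at hB ⊢
  field_simp
  ring

theorem hasDerivAt_baseCoeff (h0 : r ≠ 0) (hB : b * r + 2 * c ≠ 0) :
    HasDerivAt (baseCoeff K b c) (2 * baseLogDeriv b c r * baseCoeff K b c r) r := by
  refine ((hasDerivAt_prefactor K h0).mul ((hasDerivAt_linear b c r).const_mul 2)).congr_deriv ?_
  simp only [baseLogDeriv, baseCoeff]
  generalize b * r + 2 * c = B at hB ⊢
  field_simp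
  ring

theorem hasDerivAt_fibreCoeff (h0 : r ≠ 0) (hA : a * r ^ 2 + b * r + c ≠ 0)
    (hB : b * r + 2 * c ≠ 0) : HasDerivAt (fibreCoeff K a b c)
    (2 * fibreLogDeriv a b c r * fibreCoeff K a b c r) r := by
  refine ((hasDerivAt_prefactor K h0).mul
    ((hasDerivAt_quadratic a b c r).div (hasDerivAt_linear b c r) hB)).congr_deriv ?_
  simp only [fibreLogDeriv, fibreCoeff, Pi.div_apply]
  generalize a * r ^ 2 + b * r + c = A at hA ⊢
  generalize b * r + 2 * c = B at hB ⊢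
  field_simp
  ring

theorem hasDerivAt_baseLogDeriv (h0 : r ≠ 0) (hB : b * r + 2 * c ≠ 0) :
    HasDerivAt (baseLogDeriv b c) ((-b ^ 2 / (b * r + 2 * c) ^ 2 + 2 / r ^ 2) / 2) r := by
  refine ((((hasDerivAt_const r b).div (hasDerivAt_linear b c r) hB).sub
    ((hasDerivAt_const r (2 : ℝ)).div (hasDerivAt_id r) h0)).div_const 2).congr_deriv ?_
  simp only [id]
  field_simp
  ring

theorem hasDerivAt_fibreLogDeriv (h0 : r ≠ 0) (hA : a * r ^ 2 + b * r + c ≠ 0)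
    (hB : b * r + 2 * c ≠ 0) : HasDerivAt (fibreLogDeriv a b c)
    ((2 * a / (a * r ^ 2 + b * r + c) - (2 * a * r + b) ^ 2 / (a * r ^ 2 + b * r + c) ^ 2
      + b ^ 2 / (b * r + 2 * c) ^ 2 + 2 / r ^ 2) / 2) r := by
  refine ((((hasDerivAt_linear (2 * a) (b / 2) r).div (hasDerivAt_quadratic a b c r) hA).sub
    ((hasDerivAt_const r b).div (hasDerivAt_linear b c r) hB)).sub
    ((hasDerivAt_const r (2 : ℝ)).div (hasDerivAt_id r) h0)).div_const 2
      |>.congr_of_eventuallyEq (.of_forall fun x => ?_) |>.congr_deriv ?_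
  · simp only [fibreLogDeriv, Pi.sub_apply, Pi.div_apply, id]
    ring
  · simp only [id]
    field_simp
    ring

theorem hasDerivAt_twist (hB : b * r + 2 * c ≠ 0) : HasDerivAt (twist a b c)
    (b * ((2 * a * r + b) * (b * r + 2 * c) - 2 * b * (a * r ^ 2 + b * r + c))
      / (2 * (b * r + 2 * c) ^ 3)) r := by
  refine (((hasDerivAt_quadratic a b c r).const_mul b).div
    (((hasDerivAt_linear b c r).pow 2).const_mul 2) ?_).congr_deriv ?_
  · simpa using hB
  · simp
    field_simp

theorem hasDerivAt_baseCurv (h0 : r ≠ 0) (hB : b * r + 2 * c ≠ 0) : HasDerivAt (baseCurv a b c)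
    (2 * (2 * a * r + b) * baseLogDeriv b c r
      + 2 * (a * r ^ 2 + b * r + c) * ((-b ^ 2 / (b * r + 2 * c) ^ 2 + 2 / r ^ 2) / 2)) r :=
  ((hasDerivAt_quadratic a b c r).const_mul 2).mul (hasDerivAt_baseLogDeriv h0 hB)

theorem hasDerivAt_sq_ratio (hB : b * r + 2 * c ≠ 0) :
    HasDerivAt (fun r : ℝ => (a * r ^ 2 + b * r + c) ^ 2 / (b * r + 2 * c) ^ 2)
    (2 * (a * r ^ 2 + b * r + c) * ((2 * a * r + b) * (b * r + 2 * c)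
      - b * (a * r ^ 2 + b * r + c)) / (b * r + 2 * c) ^ 3) r := by
  refine (((hasDerivAt_quadratic a b c r).pow 2).div
    ((hasDerivAt_linear b c r).pow 2) ?_).congr_deriv ?_
  · simpa using hB
  · simp
    field_simp

theorem hasDerivAt_fibreCurv (h0 : r ≠ 0) (hA : a * r ^ 2 + b * r + c ≠ 0)
    (hB : b * r + 2 * c ≠ 0) : HasDerivAt (fibreCurv a b c)
    (2 * (a * r ^ 2 + b * r + c) * ((2 * a * r + b) * (b * r + 2 * c)
      - b * (a * r ^ 2 + b * r + c)) / (b * r + 2 * c) ^ 3 * fibreLogDeriv a b c r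
      + (a * r ^ 2 + b * r + c) ^ 2 / (b * r + 2 * c) ^ 2
        * ((2 * a / (a * r ^ 2 + b * r + c) - (2 * a * r + b) ^ 2 / (a * r ^ 2 + b * r + c) ^ 2
          + b ^ 2 / (b * r + 2 * c) ^ 2 + 2 / r ^ 2) / 2)) r :=
  (hasDerivAt_sq_ratio hB).mul (hasDerivAt_fibreLogDeriv h0 hA hB)

end Radial

variable (a b c) in
/-- The derivative of `connCoeff` with respect to `ρ`. -/
def connCoeffDeriv (r : ℝ) (d : Fin 4) : Matrix (Fin 4) (Fin 4) ℝ :=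
  Matrix.of fun i j => deriv (fun s => connCoeff a b c s d i j) r

theorem pderiv_radial {F : ℝ → ℝ} {F' : ℝ} {p : Fin 4 → ℝ} (h : HasDerivAt F F' (p 0))
    (i : Fin 4) : pderiv i (fun q => F (q 0)) p = if i = 0 then F' else 0 := by
  have := (h.hasFDerivAt.comp p (hasFDerivAt_apply (𝕜 := ℝ) 0 p)).fderiv
  unfold pderiv
  change fderiv ℝ (F ∘ fun q : Fin 4 → ℝ => q 0) p _ = _
  rw [this]
  fin_cases i <;> simp

theorem mderiv_radial {M : ℝ → Matrix (Fin 4) (Fin 4) ℝ} {M' : Matrix (Fin 4) (Fin 4) ℝ}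
    {p : Fin 4 → ℝ} (h : ∀ x y, HasDerivAt (fun r => M r x y) (M' x y) (p 0)) (i : Fin 4) :
    mderiv i (fun q => M (q 0)) p = if i = 0 then M' else 0 := by
  ext x y
  refine (pderiv_radial (h x y) i).trans ?_
  split_ifs <;> rfl

theorem pderiv_coord {p : Fin 4 → ℝ} (i j : Fin 4) :
    pderiv i (fun q => q j) p = if i = j then 1 else 0 := by
  unfold pderiv
  rw [(hasFDerivAt_apply (𝕜 := ℝ) j p).fderiv]
  simp [Pi.single_apply, eq_comm]

theorem hasFDerivAt_conf (p : Fin 4 → ℝ) : HasFDerivAt (conf a)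
    (a • (p 1 • ContinuousLinearMap.proj (R := ℝ) (φ := fun _ : Fin 4 => ℝ) 1
      + p 2 • ContinuousLinearMap.proj (R := ℝ) (φ := fun _ : Fin 4 => ℝ) 2)) p := by
  have h := fun i : Fin 4 => (hasFDerivAt_apply (𝕜 := ℝ) i p).pow 2
  refine ((((h 1).add (h 2)).const_mul (a / 2)).const_add 1).congr_fderiv ?_
  ext v
  simp
  ring

theorem pderiv_inv_conf {p : Fin 4 → ℝ} (hp : conf a p ≠ 0) (i : Fin 4) :
    pderiv i (fun q => (conf a q)⁻¹) p
      = -(a * (if i = 1 then p 1 else if i = 2 then p 2 else 0)) / conf a p ^ 2 := by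
  unfold pderiv
  change fderiv ℝ ((fun y => y⁻¹) ∘ conf a) p _ = _
  rw [((hasDerivAt_inv hp).comp_hasFDerivAt p (hasFDerivAt_conf p)).fderiv]
  fin_cases i <;> simp <;> ring

theorem contDiffAt_connCoeff {r : ℝ} (h0 : r ≠ 0) (hA : a * r ^ 2 + b * r + c ≠ 0)
    (hB : b * r + 2 * c ≠ 0) (d x y : Fin 4) :
    ContDiffAt ℝ ∞ (fun r => connCoeff a b c r d x y) r := by
  have hB2 : (b * r + 2 * c) ^ 2 ≠ 0 := pow_ne_zero 2 hB
  have hB3 : 2 * (b * r + 2 * c) ^ 2 ≠ 0 := mul_ne_zero two_ne_zero hB2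
  have h1 : ContDiffAt ℝ ∞ (radialLogDeriv a b c) r := by
    unfold radialLogDeriv; fun_prop (disch := assumption)
  have h2 : ContDiffAt ℝ ∞ (baseLogDeriv b c) r := by
    unfold baseLogDeriv; fun_prop (disch := assumption)
  have h3 : ContDiffAt ℝ ∞ (fibreLogDeriv a b c) r := by
    unfold fibreLogDeriv; fun_prop (disch := assumption)
  have h4 : ContDiffAt ℝ ∞ (twist a b c) r := by
    unfold twist; fun_prop (disch := assumption)
  have h5 : ContDiffAt ℝ ∞ (baseCurv a b c) r := by
    unfold baseCurv; fun_prop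
  have h6 : ContDiffAt ℝ ∞ (fibreCurv a b c) r := by
    unfold fibreCurv; fun_prop (disch := assumption)
  fin_cases d <;> fin_cases x <;> fin_cases y <;>
    simp [connCoeff] <;> first | assumption | fun_prop

theorem hasDerivAt_connCoeff {r : ℝ} (h0 : r ≠ 0) (hA : a * r ^ 2 + b * r + c ≠ 0)
    (hB : b * r + 2 * c ≠ 0) (d x y : Fin 4) :
    HasDerivAt (fun r => connCoeff a b c r d x y) (connCoeffDeriv a b c r d x y) r :=
  ((contDiffAt_connCoeff h0 hA hB d x y).differentiableAt (by simp)).hasDerivAt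

theorem hasDerivAt_horizCorr {r : ℝ} (h0 : r ≠ 0) (hA : a * r ^ 2 + b * r + c ≠ 0)
    (hB : b * r + 2 * c ≠ 0) (x y : Fin 4) :
    HasDerivAt (fun r => horizCorr a b c r x y) ((b • connCoeffDeriv a b c r 3) x y) r :=
  ((hasDerivAt_connCoeff h0 hA hB 3 x y).const_mul b).sub_const _

/-- The derivatives of `(M₀(ρ) + x M₁(ρ) + y M₂(ρ)) / D` with `D = 1 + (a/2)|ζ|²`. The coframe and
the horizontal connection matrices have this form. -/
theorem mderiv_horizontal {M₀ M₁ M₂ : ℝ → Matrix (Fin 4) (Fin 4) ℝ}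
    {M₀' M₁' M₂' : Matrix (Fin 4) (Fin 4) ℝ} {p : Fin 4 → ℝ} (hp : conf a p ≠ 0)
    (h₀ : ∀ x y, HasDerivAt (fun r => M₀ r x y) (M₀' x y) (p 0))
    (h₁ : ∀ x y, HasDerivAt (fun r => M₁ r x y) (M₁' x y) (p 0))
    (h₂ : ∀ x y, HasDerivAt (fun r => M₂ r x y) (M₂' x y) (p 0))
    {f : (Fin 4 → ℝ) → Matrix (Fin 4) (Fin 4) ℝ}
    (hf : f = fun q => (conf a q)⁻¹ • (M₀ (q 0) + q 1 • M₁ (q 0) + q 2 • M₂ (q 0))) :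
    mderiv 0 f p = (conf a p)⁻¹ • (M₀' + p 1 • M₁' + p 2 • M₂') ∧
    mderiv 1 f p =
      (-(a * p 1) / conf a p ^ 2) • (M₀ (p 0) + p 1 • M₁ (p 0) + p 2 • M₂ (p 0))
        + (conf a p)⁻¹ • M₁ (p 0) ∧
    mderiv 2 f p =
      (-(a * p 2) / conf a p ^ 2) • (M₀ (p 0) + p 1 • M₁ (p 0) + p 2 • M₂ (p 0))
        + (conf a p)⁻¹ • M₂ (p 0) ∧
    mderiv 3 f p = 0 := by
  subst hf
  have key : ∀ i x y, mderiv i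
      (fun q => (conf a q)⁻¹ • (M₀ (q 0) + q 1 • M₁ (q 0) + q 2 • M₂ (q 0))) p x y =
      -(a * (if i = 1 then p 1 else if i = 2 then p 2 else 0)) / conf a p ^ 2
        * (M₀ (p 0) x y + p 1 * M₁ (p 0) x y + p 2 * M₂ (p 0) x y)
      + (conf a p)⁻¹ * ((if i = 0 then M₀' x y else 0)
        + ((if i = 1 then 1 else 0) * M₁ (p 0) x y + p 1 * (if i = 0 then M₁' x y else 0))
        + ((if i = 2 then 1 else 0) * M₂ (p 0) x y + p 2 * (if i = 0 then M₂' x y else 0))) := by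
    intro i x y
    have hc : DifferentiableAt ℝ (fun q => (conf a q)⁻¹) p :=
      ((hasDerivAt_inv hp).comp_hasFDerivAt p (hasFDerivAt_conf p)).differentiableAt
    have hd : ∀ {F : ℝ → ℝ} {F' : ℝ}, HasDerivAt F F' (p 0) →
        DifferentiableAt ℝ (fun q : Fin 4 → ℝ => F (q 0)) p := fun h =>
      h.differentiableAt.comp p (differentiableAt_apply 0 p)
    have d0 := hd (h₀ x y)
    have d1 := hd (h₁ x y)
    have d2 := hd (h₂ x y)
    have e1 := differentiableAt_apply (𝕜 := ℝ) (1 : Fin 4) p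
    have e2 := differentiableAt_apply (𝕜 := ℝ) (2 : Fin 4) p
    simp only [mderiv, Matrix.of_apply, Matrix.smul_apply, Matrix.add_apply, smul_eq_mul]
    rw [pderiv_mul hc ((d0.fun_add (e1.fun_mul d1)).fun_add (e2.fun_mul d2)), pderiv_inv_conf hp,
      pderiv_add (d0.fun_add (e1.fun_mul d1)) (e2.fun_mul d2), pderiv_add d0 (e1.fun_mul d1),
      pderiv_mul e1 d1, pderiv_mul e2 d2, pderiv_radial (h₀ x y), pderiv_radial (h₁ x y),
      pderiv_radial (h₂ x y), pderiv_coord, pderiv_coord]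
  refine ⟨?_, ?_, ?_, ?_⟩ <;> ext x y <;> rw [key] <;>
    simp only [Matrix.add_apply, Matrix.smul_apply, smul_eq_mul, Matrix.zero_apply] <;> simp

theorem coframe_eq (p : Fin 4 → ℝ) : coframe K a b p =
    !![1, 0, 0, 0; 0, 0, 0, 0; 0, 0, 0, 0; 0, 0, 0, -1 / K]
      + (conf a p)⁻¹ • (!![0, 0, 0, 0; 0, 1, 0, 0; 0, 0, 1, 0; 0, 0, 0, 0]
        + p 1 • !![0, 0, 0, 0; 0, 0, 0, 0; 0, 0, 0, 0; 0, 0, -b, 0]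
        + p 2 • !![0, 0, 0, 0; 0, 0, 0, 0; 0, 0, 0, 0; 0, b, 0, 0]) := by
  ext i j
  fin_cases i <;> fin_cases j <;> simp [coframe] <;> ring

theorem contDiffOn_inv_conf : ContDiffOn ℝ ∞ (fun q => (conf a q)⁻¹) (abcDomain a b c) := by
  refine ContDiffOn.inv ?_ fun q hq => conf_ne_zero hq
  unfold conf
  fun_prop

theorem contDiffOn_radial {F : ℝ → ℝ}
    (hF : ∀ r, r ≠ 0 → a * r ^ 2 + b * r + c ≠ 0 → b * r + 2 * c ≠ 0 → ContDiffAt ℝ ∞ F r) :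
    ContDiffOn ℝ ∞ (fun q => F (q 0)) (abcDomain a b c) := by
  rintro q ⟨h0, hA, hB, -⟩
  exact ((hF _ h0.ne' hA.ne' hB).comp q (contDiff_apply ℝ ℝ 0).contDiffAt).contDiffWithinAt

theorem contDiffOn_horizontal {f₀ f₁ f₂ : (Fin 4 → ℝ) → ℝ}
    (h₀ : ContDiffOn ℝ ∞ f₀ (abcDomain a b c)) (h₁ : ContDiffOn ℝ ∞ f₁ (abcDomain a b c))
    (h₂ : ContDiffOn ℝ ∞ f₂ (abcDomain a b c)) :
    ContDiffOn ℝ ∞ (fun q => (conf a q)⁻¹ * (f₀ q + q 1 * f₁ q + q 2 * f₂ q))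
      (abcDomain a b c) :=
  contDiffOn_inv_conf.mul ((h₀.add ((contDiff_apply ℝ ℝ 1).contDiffOn.mul h₁)).add
    ((contDiff_apply ℝ ℝ 2).contDiffOn.mul h₂))

theorem mSmoothOn_coframe : MSmoothOn (coframe K a b) (abcDomain a b c) := by
  intro x y
  simp only [coframe_eq, Matrix.add_apply, Matrix.smul_apply, smul_eq_mul]
  exact contDiffOn_const.add (contDiffOn_horizontal contDiffOn_const contDiffOn_const
    contDiffOn_const)

theorem mSmoothOn_frame : MSmoothOn (frame K a b) (abcDomain a b c) := by
  intro x y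
  fin_cases x <;> fin_cases y <;> simp [frame, conf] <;> fun_prop

theorem mSmoothOn_gram : MSmoothOn (gram K a b c) (abcDomain a b c) := by
  have h1 : ContDiffOn ℝ ∞ (fun q => radialCoeff K a b c (q 0)) (abcDomain a b c) :=
    contDiffOn_radial fun r h0 hA hB => by
      have h4 : 4 * r ^ 2 ≠ 0 := mul_ne_zero four_ne_zero (pow_ne_zero 2 h0)
      unfold radialCoeff; fun_prop (disch := assumption)
  have h2 : ContDiffOn ℝ ∞ (fun q => baseCoeff K b c (q 0)) (abcDomain a b c) :=
    contDiffOn_radial fun r h0 hA hB => by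
      have h4 : 4 * r ^ 2 ≠ 0 := mul_ne_zero four_ne_zero (pow_ne_zero 2 h0)
      unfold baseCoeff; fun_prop (disch := assumption)
  have h3 : ContDiffOn ℝ ∞ (fun q => fibreCoeff K a b c (q 0)) (abcDomain a b c) :=
    contDiffOn_radial fun r h0 hA hB => by
      have h4 : 4 * r ^ 2 ≠ 0 := mul_ne_zero four_ne_zero (pow_ne_zero 2 h0)
      unfold fibreCoeff; fun_prop (disch := assumption)
  intro x y
  fin_cases x <;> fin_cases y <;> simp [gram] <;> first | assumption | exact contDiffOn_const

theorem mSmoothOn_conn (i : Fin 4) : MSmoothOn (conn K a b c i) (abcDomain a b c) := by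
  intro x y
  have hW : ∀ d, ContDiffOn ℝ ∞ (fun q => connCoeff a b c (q 0) d x y) (abcDomain a b c) :=
    fun d => contDiffOn_radial fun r h0 hA hB => contDiffAt_connCoeff h0 hA hB d x y
  have hV : ContDiffOn ℝ ∞ (fun q => horizCorr a b c (q 0) x y) (abcDomain a b c) :=
    (contDiffOn_const.mul (hW 3)).sub contDiffOn_const
  fin_cases i
  · exact hW 0
  · exact contDiffOn_horizontal (hW 1) contDiffOn_const hV
  · exact contDiffOn_horizontal (hW 2) hV.neg contDiffOn_const
  · exact contDiffOn_const.mul (hW 3)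

/-! ### Compatibility of the connection with the metric -/

theorem connCoeff_skew {r : ℝ} (h0 : r ≠ 0) (hA : a * r ^ 2 + b * r + c ≠ 0)
    (hB : b * r + 2 * c ≠ 0) {p : Fin 4 → ℝ} (hr : p 0 = r) (d : Fin 4) (hd : d ≠ 0) :
    (connCoeff a b c r d)ᵀ * gram K a b c p + gram K a b c p * connCoeff a b c r d = 0 := by
  ext x y
  fin_cases d
  · exact absurd rfl hd
  all_goals
    fin_cases x <;> fin_cases y <;>
      simp [connCoeff, gram, hr, baseCurv, fibreCurv, twist, radialCoeff, baseCoeff, fibreCoeff] <;>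
      generalize a * r ^ 2 + b * r + c = A at hA ⊢ <;>
      generalize b * r + 2 * c = B at hB ⊢ <;>
      field_simp <;> ring

theorem baseRot_skew (p : Fin 4 → ℝ) :
    baseRotᵀ * gram K a b c p + gram K a b c p * baseRot = 0 := by
  ext x y
  fin_cases x <;> fin_cases y <;> simp [baseRot, gram]

theorem horizCorr_skew {r : ℝ} (h0 : r ≠ 0) (hA : a * r ^ 2 + b * r + c ≠ 0)
    (hB : b * r + 2 * c ≠ 0) {p : Fin 4 → ℝ} (hr : p 0 = r) :
    (horizCorr a b c r)ᵀ * gram K a b c p + gram K a b c p * horizCorr a b c r = 0 := by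
  have h1 := connCoeff_skew (K := K) h0 hA hB hr 3 (by decide)
  have h2 := baseRot_skew (K := K) (a := a) (b := b) (c := c) p
  have : (horizCorr a b c r)ᵀ * gram K a b c p + gram K a b c p * horizCorr a b c r
      = b • ((connCoeff a b c r 3)ᵀ * gram K a b c p + gram K a b c p * connCoeff a b c r 3)
        - a • (baseRotᵀ * gram K a b c p + gram K a b c p * baseRot) := by
    simp only [horizCorr, Matrix.transpose_sub, Matrix.transpose_smul, sub_mul, mul_sub,
      Matrix.smul_mul, Matrix.mul_smul]
    module
  rw [this, h1, h2, smul_zero, smul_zero, sub_zero]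

theorem mderiv_gram {p : Fin 4 → ℝ} (hp : p ∈ abcDomain a b c) (i : Fin 4) :
    mderiv i (gram K a b c) p = if i = 0 then
      (connCoeff a b c (p 0) 0)ᵀ * gram K a b c p + gram K a b c p * connCoeff a b c (p 0) 0
      else 0 := by
  obtain ⟨h0, hA, hB, -⟩ := hp
  have h1 := hasDerivAt_radialCoeff (K := K) h0.ne' hA.ne' hB
  have h2 := hasDerivAt_baseCoeff (K := K) h0.ne' hB
  have h3 := hasDerivAt_fibreCoeff (K := K) h0.ne' hA.ne' hB
  exact mderiv_radial (M := fun r => Matrix.diagonal ![radialCoeff K a b c r,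
    baseCoeff K b c r, baseCoeff K b c r, fibreCoeff K a b c r]) (by
      intro x y
      fin_cases x <;> fin_cases y <;> simp [connCoeff, gram] <;>
        first
        | exact hasDerivAt_const _ _
        | exact h1.congr_deriv (by ring)
        | exact h2.congr_deriv (by ring)
        | exact h3.congr_deriv (by ring)) i

theorem conn_metric {p : Fin 4 → ℝ} (hp : p ∈ abcDomain a b c) (i : Fin 4) :
    mderiv i (gram K a b c) p
      = (conn K a b c i p)ᵀ * gram K a b c p + gram K a b c p * conn K a b c i p := by
  rw [mderiv_gram hp]
  obtain ⟨h0, hA, hB, -⟩ := hp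
  have hs := fun d => connCoeff_skew (K := K) h0.ne' hA.ne' hB rfl d
  have hV := horizCorr_skew (K := K) h0.ne' hA.ne' hB rfl
  have hlin : ∀ (t y : ℝ) {M N : Matrix (Fin 4) (Fin 4) ℝ},
      Mᵀ * gram K a b c p + gram K a b c p * M = 0 →
      Nᵀ * gram K a b c p + gram K a b c p * N = 0 →
      0 = (t • (M + y • N))ᵀ * gram K a b c p + gram K a b c p * (t • (M + y • N)) := by
    intro t y M N hM hN
    have : (t • (M + y • N))ᵀ * gram K a b c p + gram K a b c p * (t • (M + y • N))
        = t • (Mᵀ * gram K a b c p + gram K a b c p * M)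
          + (t * y) • (Nᵀ * gram K a b c p + gram K a b c p * N) := by
      simp only [Matrix.transpose_add, Matrix.transpose_smul, add_mul, mul_add, smul_add,
        Matrix.smul_mul, Matrix.mul_smul]
      module
    rw [this, hM, hN, smul_zero, smul_zero, add_zero]
  fin_cases i
  · rfl
  · simpa [conn] using hlin (conf a p)⁻¹ (p 2) (hs 1 (by decide)) hV
  · simpa [conn] using hlin (conf a p)⁻¹ (-p 1) (hs 2 (by decide)) hV
  · simpa [conn] using hlin (-1 / K) 0 (hs 3 (by decide)) hV

/-! ### Vanishing of the torsion -/

theorem mderiv_coframe {p : Fin 4 → ℝ} (hp : p ∈ abcDomain a b c) :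
    mderiv 0 (coframe K a b) p = 0 ∧
    mderiv 1 (coframe K a b) p =
      !![0, 0, 0, 0; 0, -(a * p 1) / conf a p ^ 2, 0, 0; 0, 0, -(a * p 1) / conf a p ^ 2, 0;
        0, -(a * p 1) / conf a p ^ 2 * (b * p 2),
          a * p 1 / conf a p ^ 2 * (b * p 1) - b / conf a p, 0] ∧
    mderiv 2 (coframe K a b) p =
      !![0, 0, 0, 0; 0, -(a * p 2) / conf a p ^ 2, 0, 0; 0, 0, -(a * p 2) / conf a p ^ 2, 0;
        0, -(a * p 2) / conf a p ^ 2 * (b * p 2) + b / conf a p,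
          a * p 2 / conf a p ^ 2 * (b * p 1), 0] ∧
    mderiv 3 (coframe K a b) p = 0 := by
  have hsum := fun i => mderiv_add
    (M := fun _ => !![1, 0, 0, 0; 0, 0, 0, 0; 0, 0, 0, 0; 0, 0, 0, -1 / K])
    (N := fun q => (conf a q)⁻¹ • (!![0, 0, 0, 0; 0, 1, 0, 0; 0, 0, 1, 0; 0, 0, 0, 0]
        + q 1 • !![0, 0, 0, 0; 0, 0, 0, 0; 0, 0, 0, 0; 0, 0, -b, 0]
        + q 2 • !![0, 0, 0, 0; 0, 0, 0, 0; 0, 0, 0, 0; 0, b, 0, 0]))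
    (isOpen_abcDomain (a := a) (b := b) (c := c)) (fun _ _ => contDiffOn_const)
    (fun x y => contDiffOn_horizontal contDiffOn_const contDiffOn_const contDiffOn_const) hp i
  obtain ⟨d0, d1, d2, d3⟩ := mderiv_horizontal
    (M₀ := fun _ => !![0, 0, 0, 0; 0, 1, 0, 0; 0, 0, 1, 0; 0, 0, 0, 0])
    (M₁ := fun _ => !![0, 0, 0, 0; 0, 0, 0, 0; 0, 0, 0, 0; 0, 0, -b, 0])
    (M₂ := fun _ => !![0, 0, 0, 0; 0, 0, 0, 0; 0, 0, 0, 0; 0, b, 0, 0])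
    (M₀' := 0) (M₁' := 0) (M₂' := 0) (conf_ne_zero hp) (fun _ _ => hasDerivAt_const _ _)
    (fun _ _ => hasDerivAt_const _ _) (fun _ _ => hasDerivAt_const _ _) rfl
  simp only [← funext (coframe_eq (K := K) (a := a) (b := b)), mderiv_const] at hsum
  rw [hsum, hsum, hsum, hsum, d0, d1, d2, d3]
  clear hsum d0 d1 d2 d3
  refine ⟨by simp, ?_, ?_, by simp⟩ <;> ext x y <;> fin_cases x <;> fin_cases y <;>
    simp [-mul_eq_zero, -zero_eq_mul, -mul_eq_mul_left_iff, -mul_eq_mul_right_iff] <;> ring1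

/-- The first structure equation `de + φ ∧ e = 0`. -/
theorem conn_torsion (hK : K ≠ 0) {p : Fin 4 → ℝ} (hp : p ∈ abcDomain a b c) (i j x : Fin 4) :
    mderiv i (coframe K a b) p x j + (conn K a b c i p * coframe K a b p) x j
      = mderiv j (coframe K a b) p x i + (conn K a b c j p * coframe K a b p) x i := by
  have hD := conf_ne_zero hp
  have hD' : a * (p 1 ^ 2 + p 2 ^ 2) = 2 * conf a p - 2 := by unfold conf; ring
  obtain ⟨d0, d1, d2, d3⟩ := mderiv_coframe (K := K) hp
  have key : ∀ i j : Fin 4, i < j → ∀ x,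
      mderiv i (coframe K a b) p x j + (conn K a b c i p * coframe K a b p) x j
        = mderiv j (coframe K a b) p x i + (conn K a b c j p * coframe K a b p) x i := by
    intro i j hij x
    obtain ⟨rfl, rfl⟩ | ⟨rfl, rfl⟩ | ⟨rfl, rfl⟩ | ⟨rfl, rfl⟩ | ⟨rfl, rfl⟩ | ⟨rfl, rfl⟩ :
        (i = 0 ∧ j = 1) ∨ (i = 0 ∧ j = 2) ∨ (i = 0 ∧ j = 3) ∨ (i = 1 ∧ j = 2) ∨ (i = 1 ∧ j = 3)
          ∨ (i = 2 ∧ j = 3) := by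
      clear x; decide +revert
    all_goals
      simp only [d0, d1, d2, d3, conn, Matrix.mul_apply, Fin.sum_univ_four]
      fin_cases x <;> simp [connCoeff, horizCorr, baseRot, coframe] <;>
        field_simp <;> first | done | ring1 | linear_combination b * hD'
  rcases lt_trichotomy i j with h | h | h
  · exact key i j h x
  · rw [h]
  · exact (key j i h x).symm

theorem isMovingFrame (hK : K ≠ 0) : IsMovingFrame (abcMetric K a b c) (abcDomain a b c)
    (coframe K a b) (frame K a b) (gram K a b c) (conn K a b c) where
  isOpen := isOpen_abcDomain
  smooth_coframe := mSmoothOn_coframe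
  smooth_frame := mSmoothOn_frame
  smooth_gram := mSmoothOn_gram
  smooth_conn := mSmoothOn_conn
  frame_mul_coframe _ hp := frame_mul_coframe hK hp
  gram_symm _ := Matrix.diagonal_transpose _
  gram_inv p hp := by
    obtain ⟨h0, hA, hB, -⟩ := hp
    rw [gram, Matrix.det_diagonal, isUnit_iff_ne_zero, Fin.prod_univ_four]
    simp [radialCoeff, baseCoeff, fibreCoeff, h0.ne', hA.ne', hB, hK]
  metric_eq p _ := abcMetric_eq p
  metric _ hp := conn_metric hp
  torsion _ hp := conn_torsion hK hp

/-! ### The curvature of the metrics `g^{a,b,c}` -/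

variable (a b c) in
/-- The components in the frame of an almost complex structure `J` that is orthogonal for
`g^{a,b,c}` and rotates `∂_ρ` into the direction of `∂_t`. -/
def frameJ (r : ℝ) : Matrix (Fin 4) (Fin 4) ℝ :=
  !![0, 0, 0, -((a * r ^ 2 + b * r + c) / (b * r + 2 * c)); 0, 0, -1, 0; 0, 1, 0, 0;
    (b * r + 2 * c) / (a * r ^ 2 + b * r + c), 0, 0, 0]

variable (K a b c) in
/-- The coefficient of the part of the curvature that depends on `J`. -/
def weylCoeff (r : ℝ) : ℝ := b * (b ^ 2 - 4 * a * c) * r ^ 3 / (K * (b * r + 2 * c) ^ 3)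

theorem gram_mul_frameJ_transpose {p : Fin 4 → ℝ} (hp : p ∈ abcDomain a b c) :
    (gram K a b c p * frameJ a b c (p 0))ᵀ = -(gram K a b c p * frameJ a b c (p 0)) := by
  obtain ⟨h0, hA, hB, -⟩ := hp
  replace h0 := h0.ne'
  replace hA := hA.ne'
  ext x y
  fin_cases x <;> fin_cases y <;> simp [gram, frameJ, radialCoeff, fibreCoeff] <;>
    generalize a * p 0 ^ 2 + b * p 0 + c = A at hA ⊢ <;>
    generalize b * p 0 + 2 * c = B at hB ⊢ <;> field_simp

variable (K a b c) in
/-- The frame components of the curvature of `g^{a,b,c}`. -/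
def frameCurv (p : Fin 4 → ℝ) (u v : Fin 4 → ℝ) : Matrix (Fin 4) (Fin 4) ℝ :=
  curvOp (gram K a b c p) (frameJ a b c (p 0)) (2 / K - weylCoeff K a b c (p 0))
    (weylCoeff K a b c (p 0)) u v

theorem connCoeffDeriv_one (r : ℝ) :
    connCoeffDeriv a b c r 1 = !![0, -deriv (baseCurv a b c) r, 0, 0;
      deriv (baseLogDeriv b c) r, 0, 0, 0; 0, 0, 0, -deriv (twist a b c) r; 0, 0, 0, 0] := by
  ext x y
  fin_cases x <;> fin_cases y <;> simp [connCoeffDeriv, connCoeff]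

theorem connCoeffDeriv_two (r : ℝ) :
    connCoeffDeriv a b c r 2 = !![0, 0, -deriv (baseCurv a b c) r, 0;
      0, 0, 0, deriv (twist a b c) r; deriv (baseLogDeriv b c) r, 0, 0, 0; 0, 0, 0, 0] := by
  ext x y
  fin_cases x <;> fin_cases y <;> simp [connCoeffDeriv, connCoeff]

theorem connCoeffDeriv_three (r : ℝ) :
    connCoeffDeriv a b c r 3 = !![0, 0, 0, -deriv (fibreCurv a b c) r;
      0, 0, deriv (twist a b c) r, 0; 0, -deriv (twist a b c) r, 0, 0;
      deriv (fibreLogDeriv a b c) r, 0, 0, 0] := by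
  ext x y
  fin_cases x <;> fin_cases y <;> simp [connCoeffDeriv, connCoeff]

/-- The curvature forms on the frame vectors `0` and `1`; the next five lemmas treat the other pairs.
The term in `horizCorr` for the pair `1`, `2` comes from the bracket of the horizontal frame vectors
and from the curvature of the base surface. -/
theorem curv_zero_one (hK : K ≠ 0) {p : Fin 4 → ℝ} (hp : p ∈ abcDomain a b c) :
    connCoeffDeriv a b c (p 0) 1 + (connCoeff a b c (p 0) 0 * connCoeff a b c (p 0) 1
      - connCoeff a b c (p 0) 1 * connCoeff a b c (p 0) 0)
      = frameCurv K a b c p (Pi.single 0 1) (Pi.single 1 1) := by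
  obtain ⟨h0, hA, hB, -⟩ := hp
  replace h0 := h0.ne'
  replace hA := hA.ne'
  rw [connCoeffDeriv_one, (hasDerivAt_baseCurv h0 hB).deriv,
    (hasDerivAt_baseLogDeriv h0 hB).deriv, (hasDerivAt_twist hB).deriv]
  generalize hr : p 0 = r at *
  ext x y
  fin_cases x <;> fin_cases y <;>
    simp [connCoeff, frameCurv, curvOp, Matrix.vecMulVec_apply, Matrix.vecMul_diagonal, gram,
      frameJ, weylCoeff, hr, baseLogDeriv, radialLogDeriv, fibreLogDeriv, baseCurv,
      twist, baseCoeff, radialCoeff, fibreCoeff] <;>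
    (generalize hAe : a * r ^ 2 + b * r + c = A at hA ⊢
     generalize hBe : b * r + 2 * c = B at hB ⊢
     field_simp
     try (subst hAe hBe; ring1))

theorem curv_zero_two (hK : K ≠ 0) {p : Fin 4 → ℝ} (hp : p ∈ abcDomain a b c) :
    connCoeffDeriv a b c (p 0) 2 + (connCoeff a b c (p 0) 0 * connCoeff a b c (p 0) 2
      - connCoeff a b c (p 0) 2 * connCoeff a b c (p 0) 0)
      = frameCurv K a b c p (Pi.single 0 1) (Pi.single 2 1) := by
  obtain ⟨h0, hA, hB, -⟩ := hp
  replace h0 := h0.ne'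
  replace hA := hA.ne'
  rw [connCoeffDeriv_two, (hasDerivAt_baseCurv h0 hB).deriv,
    (hasDerivAt_baseLogDeriv h0 hB).deriv, (hasDerivAt_twist hB).deriv]
  generalize hr : p 0 = r at *
  ext x y
  fin_cases x <;> fin_cases y <;>
    simp [connCoeff, frameCurv, curvOp, Matrix.vecMulVec_apply, Matrix.vecMul_diagonal, gram,
      frameJ, weylCoeff, hr, baseLogDeriv, radialLogDeriv, fibreLogDeriv, baseCurv,
      twist, baseCoeff, radialCoeff, fibreCoeff] <;>
    (generalize hAe : a * r ^ 2 + b * r + c = A at hA ⊢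
     generalize hBe : b * r + 2 * c = B at hB ⊢
     field_simp
     try (subst hAe hBe; ring1))

theorem curv_zero_three (hK : K ≠ 0) {p : Fin 4 → ℝ} (hp : p ∈ abcDomain a b c) :
    connCoeffDeriv a b c (p 0) 3 + (connCoeff a b c (p 0) 0 * connCoeff a b c (p 0) 3
      - connCoeff a b c (p 0) 3 * connCoeff a b c (p 0) 0)
      = frameCurv K a b c p (Pi.single 0 1) (Pi.single 3 1) := by
  obtain ⟨h0, hA, hB, -⟩ := hp
  replace h0 := h0.ne'
  replace hA := hA.ne'
  rw [connCoeffDeriv_three, (hasDerivAt_fibreCurv h0 hA hB).deriv,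
    (hasDerivAt_twist hB).deriv, (hasDerivAt_fibreLogDeriv h0 hA hB).deriv]
  generalize hr : p 0 = r at *
  ext x y
  fin_cases x <;> fin_cases y <;>
    simp [connCoeff, frameCurv, curvOp, Matrix.vecMulVec_apply, Matrix.vecMul_diagonal, gram,
      frameJ, weylCoeff, hr, baseLogDeriv, radialLogDeriv, fibreLogDeriv, fibreCurv,
      twist, baseCoeff, radialCoeff, fibreCoeff] <;>
    (generalize hAe : a * r ^ 2 + b * r + c = A at hA ⊢
     generalize hBe : b * r + 2 * c = B at hB ⊢
     field_simp
     try (subst hAe hBe; ring1))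

theorem curv_one_two (hK : K ≠ 0) {p : Fin 4 → ℝ} (hp : p ∈ abcDomain a b c) :
    (connCoeff a b c (p 0) 1 * connCoeff a b c (p 0) 2
      - connCoeff a b c (p 0) 2 * connCoeff a b c (p 0) 1) - (2 : ℝ) • horizCorr a b c (p 0)
      = frameCurv K a b c p (Pi.single 1 1) (Pi.single 2 1) := by
  obtain ⟨h0, hA, hB, -⟩ := hp
  replace h0 := h0.ne'
  replace hA := hA.ne'
  generalize hr : p 0 = r at *
  ext x y
  fin_cases x <;> fin_cases y <;>
    simp [connCoeff, frameCurv, curvOp, Matrix.vecMulVec_apply, gram,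
      frameJ, weylCoeff, hr, baseLogDeriv, fibreLogDeriv, baseCurv, fibreCurv,
      twist, baseCoeff, radialCoeff, fibreCoeff, horizCorr, baseRot] <;>
    (generalize hAe : a * r ^ 2 + b * r + c = A at hA ⊢
     generalize hBe : b * r + 2 * c = B at hB ⊢
     field_simp
     try (subst hAe hBe; ring1))

theorem curv_one_three (hK : K ≠ 0) {p : Fin 4 → ℝ} (hp : p ∈ abcDomain a b c) :
    connCoeff a b c (p 0) 1 * connCoeff a b c (p 0) 3
      - connCoeff a b c (p 0) 3 * connCoeff a b c (p 0) 1
      = frameCurv K a b c p (Pi.single 1 1) (Pi.single 3 1) := by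
  obtain ⟨h0, hA, hB, -⟩ := hp
  replace h0 := h0.ne'
  replace hA := hA.ne'
  generalize hr : p 0 = r at *
  ext x y
  fin_cases x <;> fin_cases y <;>
    simp [connCoeff, frameCurv, curvOp, Matrix.vecMulVec_apply, gram,
      frameJ, weylCoeff, hr, baseLogDeriv, fibreLogDeriv, baseCurv, fibreCurv,
      twist, baseCoeff, radialCoeff, fibreCoeff] <;>
    (generalize hAe : a * r ^ 2 + b * r + c = A at hA ⊢
     generalize hBe : b * r + 2 * c = B at hB ⊢
     field_simp
     try (subst hAe hBe; ring1))

theorem curv_two_three (hK : K ≠ 0) {p : Fin 4 → ℝ} (hp : p ∈ abcDomain a b c) :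
    connCoeff a b c (p 0) 2 * connCoeff a b c (p 0) 3
      - connCoeff a b c (p 0) 3 * connCoeff a b c (p 0) 2
      = frameCurv K a b c p (Pi.single 2 1) (Pi.single 3 1) := by
  obtain ⟨h0, hA, hB, -⟩ := hp
  replace h0 := h0.ne'
  replace hA := hA.ne'
  generalize hr : p 0 = r at *
  ext x y
  fin_cases x <;> fin_cases y <;>
    simp [connCoeff, frameCurv, curvOp, Matrix.vecMulVec_apply, gram,
      frameJ, weylCoeff, hr, baseLogDeriv, fibreLogDeriv, baseCurv, fibreCurv,
      twist, baseCoeff, radialCoeff, fibreCoeff] <;>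
    (generalize hAe : a * r ^ 2 + b * r + c = A at hA ⊢
     generalize hBe : b * r + 2 * c = B at hB ⊢
     field_simp
     try (subst hAe hBe; ring1))

theorem connCoeff_zero_comm_horizCorr (r : ℝ) :
    connCoeff a b c r 0 * horizCorr a b c r - horizCorr a b c r * connCoeff a b c r 0
      = b • (connCoeff a b c r 0 * connCoeff a b c r 3
        - connCoeff a b c r 3 * connCoeff a b c r 0) := by
  have : connCoeff a b c r 0 * baseRot = baseRot * connCoeff a b c r 0 := by
    ext x y
    fin_cases x <;> fin_cases y <;> simp [connCoeff, baseRot]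
  simp only [horizCorr, mul_sub, sub_mul, Matrix.mul_smul, Matrix.smul_mul, this]
  module

theorem connCoeff_three_comm_horizCorr (r : ℝ) :
    connCoeff a b c r 3 * horizCorr a b c r - horizCorr a b c r * connCoeff a b c r 3 = 0 := by
  have : connCoeff a b c r 3 * baseRot = baseRot * connCoeff a b c r 3 := by
    ext x y
    fin_cases x <;> fin_cases y <;> simp [connCoeff, baseRot]
  simp only [horizCorr, mul_sub, sub_mul, Matrix.mul_smul, Matrix.smul_mul, this]
  module

theorem connCoeff_one_comm_horizCorr (r : ℝ) :
    connCoeff a b c r 1 * horizCorr a b c r - horizCorr a b c r * connCoeff a b c r 1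
      = b • (connCoeff a b c r 1 * connCoeff a b c r 3
        - connCoeff a b c r 3 * connCoeff a b c r 1) - a • connCoeff a b c r 2 := by
  have : connCoeff a b c r 1 * baseRot = baseRot * connCoeff a b c r 1 + connCoeff a b c r 2 := by
    ext x y
    fin_cases x <;> fin_cases y <;> simp [connCoeff, baseRot]
  simp only [horizCorr, mul_sub, sub_mul, Matrix.mul_smul, Matrix.smul_mul, this]
  module

theorem connCoeff_two_comm_horizCorr (r : ℝ) :
    connCoeff a b c r 2 * horizCorr a b c r - horizCorr a b c r * connCoeff a b c r 2
      = b • (connCoeff a b c r 2 * connCoeff a b c r 3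
        - connCoeff a b c r 3 * connCoeff a b c r 2) + a • connCoeff a b c r 1 := by
  have : connCoeff a b c r 2 * baseRot = baseRot * connCoeff a b c r 2 - connCoeff a b c r 1 := by
    ext x y
    fin_cases x <;> fin_cases y <;> simp [connCoeff, baseRot]
  simp only [horizCorr, mul_sub, sub_mul, Matrix.mul_smul, Matrix.smul_mul, this]
  module

theorem coframe_col (p : Fin 4 → ℝ) :
    (coframe K a b p).col 0 = Pi.single 0 1 ∧
    (coframe K a b p).col 1 = (conf a p)⁻¹ • (Pi.single 1 1 + (b * p 2) • Pi.single 3 1) ∧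
    (coframe K a b p).col 2 = (conf a p)⁻¹ • (Pi.single 2 1 + (-(b * p 1)) • Pi.single 3 1) ∧
    (coframe K a b p).col 3 = (-1 / K) • Pi.single 3 1 := by
  refine ⟨?_, ?_, ?_, ?_⟩ <;> ext x <;> fin_cases x <;>
    simp [coframe, Matrix.col] <;> ring

theorem mderiv_conn {p : Fin 4 → ℝ} (hp : p ∈ abcDomain a b c) :
    (∀ i, i ≠ 0 → mderiv i (conn K a b c 0) p = 0) ∧
    mderiv 0 (conn K a b c 3) p = (-1 / K) • connCoeffDeriv a b c (p 0) 3 ∧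
    ∀ i, i ≠ 0 → mderiv i (conn K a b c 3) p = 0 := by
  obtain ⟨h0, hA, hB, -⟩ := hp
  have hW := fun d => hasDerivAt_connCoeff h0.ne' hA.ne' hB d
  have h3 := mderiv_radial (p := p) (M := fun r => (-1 / K) • connCoeff a b c r 3)
    (M' := (-1 / K) • connCoeffDeriv a b c (p 0) 3) fun x y => (hW 3 x y).const_mul _
  refine ⟨fun i hi => ?_, ?_, fun i hi => ?_⟩
  · exact (mderiv_radial (M := fun r => connCoeff a b c r 0) (hW 0) i).trans (if_neg hi)
  · exact (h3 0).trans (if_pos rfl)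
  · exact (h3 i).trans (if_neg hi)

/-- The curvature forms of the connection. Both sides are bilinear in the frame, so that the
components on coordinate vector fields follow from the six identities for pairs of frame vectors. -/
theorem conn_curvature (hK : K ≠ 0) {p : Fin 4 → ℝ} (hp : p ∈ abcDomain a b c) (i j : Fin 4) :
    mderiv i (conn K a b c j) p - mderiv j (conn K a b c i) p
      + (conn K a b c i p * conn K a b c j p - conn K a b c j p * conn K a b c i p)
      = frameCurv K a b c p ((coframe K a b p).col i) ((coframe K a b p).col j) := by
  have hF := gram_mul_frameJ_transpose (K := K) hp
  have add_right : ∀ u v w, frameCurv K a b c p u (v + w)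
      = frameCurv K a b c p u v + frameCurv K a b c p u w := curvOp_add_right
  have smul_right : ∀ (r : ℝ) u v, frameCurv K a b c p u (r • v) = r • frameCurv K a b c p u v :=
    curvOp_smul_right
  have swap : ∀ u v, frameCurv K a b c p v u = -frameCurv K a b c p u v := curvOp_swap hF
  have self : ∀ u, frameCurv K a b c p u u = 0 := curvOp_self hF
  have add_left : ∀ u v w, frameCurv K a b c p (v + w) u
      = frameCurv K a b c p v u + frameCurv K a b c p w u := fun u v w => by
    rw [swap, add_right, swap v, swap w]; abel
  have smul_left : ∀ (r : ℝ) u v, frameCurv K a b c p (r • v) u = r • frameCurv K a b c p v u :=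
    fun r u v => by rw [swap, smul_right, swap v, smul_neg, neg_neg]
  obtain ⟨c0, c1, c2, c3⟩ := coframe_col (K := K) (a := a) (b := b) p
  obtain ⟨m0, m30, m3⟩ := mderiv_conn (K := K) hp
  have hD := conf_ne_zero hp
  have hd : (conf a p)⁻¹ = (conf a p)⁻¹ ^ 2 * (1 + a / 2 * (p 1 ^ 2 + p 2 ^ 2)) := by
    change _ = _ * conf a p
    field_simp
  have hW := fun d => hasDerivAt_connCoeff hp.1.ne' hp.2.1.ne' hp.2.2.1 d
  have hV := hasDerivAt_horizCorr hp.1.ne' hp.2.1.ne' hp.2.2.1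
  obtain ⟨m10, m11, m12, m13⟩ := mderiv_horizontal (f := conn K a b c 1)
    (M₀ := fun r => connCoeff a b c r 1) (M₁ := fun _ => 0) (M₂ := horizCorr a b c) (M₁' := 0)
    hD (hW 1) (fun _ _ => hasDerivAt_const _ _) hV rfl
  obtain ⟨m20, m21, m22, m23⟩ := mderiv_horizontal (f := conn K a b c 2)
    (M₀ := fun r => connCoeff a b c r 2) (M₁ := fun r => -horizCorr a b c r) (M₂ := fun _ => 0)
    (M₁' := -(b • connCoeffDeriv a b c (p 0) 3)) (M₂' := 0)
    hD (hW 2) (fun x y => (hV x y).neg) (fun _ _ => hasDerivAt_const _ _) rfl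
  have k0 := connCoeff_zero_comm_horizCorr (a := a) (b := b) (c := c) (p 0)
  have k1 := connCoeff_one_comm_horizCorr (a := a) (b := b) (c := c) (p 0)
  have k2 := connCoeff_two_comm_horizCorr (a := a) (b := b) (c := c) (p 0)
  have k3 := connCoeff_three_comm_horizCorr (a := a) (b := b) (c := c) (p 0)
  rw [sub_eq_iff_eq_add] at k0 k1 k2 k3
  have key : ∀ i j : Fin 4, i < j →
      mderiv i (conn K a b c j) p - mderiv j (conn K a b c i) p
        + (conn K a b c i p * conn K a b c j p - conn K a b c j p * conn K a b c i p)
        = frameCurv K a b c p ((coframe K a b p).col i) ((coframe K a b p).col j) := by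
    intro i j hij
    obtain ⟨rfl, rfl⟩ | ⟨rfl, rfl⟩ | ⟨rfl, rfl⟩ | ⟨rfl, rfl⟩ | ⟨rfl, rfl⟩ | ⟨rfl, rfl⟩ :
        (i = 0 ∧ j = 1) ∨ (i = 0 ∧ j = 2) ∨ (i = 0 ∧ j = 3) ∨ (i = 1 ∧ j = 2) ∨ (i = 1 ∧ j = 3)
          ∨ (i = 2 ∧ j = 3) := by
      decide +revert
    · rw [m10, m0 1 (by decide), c0, c1, smul_right, add_right, smul_right,
        ← curv_zero_one hK hp, ← curv_zero_three hK hp]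
      simp only [conn, smul_zero, add_zero, mul_add, add_mul, Matrix.mul_smul, Matrix.smul_mul, k0]
      module
    · rw [m20, m0 2 (by decide), c0, c2, smul_right, add_right, smul_right,
        ← curv_zero_two hK hp, ← curv_zero_three hK hp]
      simp only [conn, smul_zero, add_zero, mul_add, add_mul, Matrix.mul_smul, Matrix.smul_mul,
        mul_neg, neg_mul, k0]
      module
    · rw [m30, m0 3 (by decide), c0, c3, smul_right, ← curv_zero_three hK hp]
      simp only [conn, Matrix.mul_smul, Matrix.smul_mul]
      module
    · rw [m21, m12, c1, c2, smul_right, smul_left, add_right, add_left, smul_right, add_left,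
        smul_left, smul_left, self, swap (Pi.single 2 1) (Pi.single 3 1),
        ← curv_one_two hK hp, ← curv_one_three hK hp, ← curv_two_three hK hp]
      simp only [conn, smul_zero, add_zero, mul_add, add_mul, Matrix.mul_smul, Matrix.smul_mul,
        mul_neg, neg_mul, k1, k2, div_eq_mul_inv, ← inv_pow]
      generalize (conf a p)⁻¹ = d at hd ⊢
      match_scalars <;> first | ring1 | linear_combination (-2) * hd
    · rw [m3 1 (by decide), m13, c1, c3, smul_right, smul_left, add_left, smul_left, self,
        ← curv_one_three hK hp]
      simp only [conn, smul_zero, add_zero, mul_add, add_mul, Matrix.mul_smul, Matrix.smul_mul, k3]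
      module
    · rw [m3 2 (by decide), m23, c2, c3, smul_right, smul_left, add_left, smul_left, self,
        ← curv_two_three hK hp]
      simp only [conn, smul_zero, add_zero, mul_add, add_mul, Matrix.mul_smul, Matrix.smul_mul,
        mul_neg, neg_mul, k3]
      module
  rcases lt_trichotomy i j with h | h | h
  · exact key i j h
  · rw [h, self]
    abel
  · rw [swap, ← key j i h]
    abel

/-! ### Locally symmetric cases -/

theorem frameJ_comm (hc : c = 0) {r : ℝ} (h0 : r ≠ 0) (hA : a * r ^ 2 + b * r + c ≠ 0)
    (hB : b * r + 2 * c ≠ 0) (d : Fin 4) (hd : d ≠ 0) :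
    connCoeff a b c r d * frameJ a b c r = frameJ a b c r * connCoeff a b c r d := by
  subst hc
  have hb : b ≠ 0 := by
    rintro rfl
    simp at hB
  have hA' : a * r + b ≠ 0 := by
    rintro h
    exact hA (by linear_combination r * h)
  have hA'' : r * a + b ≠ 0 := by rwa [mul_comm r a]
  obtain rfl | rfl | rfl : d = 1 ∨ d = 2 ∨ d = 3 := by revert hd; clear * -; decide +revert
  all_goals
    ext x y
    fin_cases x <;> fin_cases y <;>
      simp [connCoeff, frameJ, baseCurv, fibreCurv, twist, baseLogDeriv, fibreLogDeriv] <;>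
      field_simp <;> ring1

theorem baseRot_comm_frameJ (r : ℝ) : baseRot * frameJ a b c r = frameJ a b c r * baseRot := by
  ext x y
  fin_cases x <;> fin_cases y <;> simp [baseRot, frameJ]

/-- For `c = 0` the almost complex structure is parallel, i.e. the metric is Kähler. -/
theorem frameJ_parallel (hc : c = 0) {p : Fin 4 → ℝ} (hp : p ∈ abcDomain a b c) (i : Fin 4) :
    mderiv i (fun q => frameJ a b c (q 0)) p
      + (conn K a b c i p * frameJ a b c (p 0) - frameJ a b c (p 0) * conn K a b c i p) = 0 := by
  obtain ⟨h0, hA, hB, -⟩ := hp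
  replace h0 := h0.ne'
  replace hA := hA.ne'
  have hAB : HasDerivAt (fun r => (a * r ^ 2 + b * r + c) / (b * r + 2 * c))
      ((a * p 0 ^ 2 + b * p 0 + c) / (b * p 0 + 2 * c)
        * (fibreLogDeriv a b c (p 0) - radialLogDeriv a b c (p 0))) (p 0) := by
    refine ((hasDerivAt_quadratic a b c (p 0)).div (hasDerivAt_linear b c (p 0)) hB).congr_deriv ?_
    simp only [fibreLogDeriv, radialLogDeriv]
    generalize a * p 0 ^ 2 + b * p 0 + c = A at hA ⊢
    generalize b * p 0 + 2 * c = B at hB ⊢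
    field_simp
    ring
  have hBA : HasDerivAt (fun r => (b * r + 2 * c) / (a * r ^ 2 + b * r + c))
      ((b * p 0 + 2 * c) / (a * p 0 ^ 2 + b * p 0 + c)
        * (radialLogDeriv a b c (p 0) - fibreLogDeriv a b c (p 0))) (p 0) := by
    refine ((hasDerivAt_linear b c (p 0)).div (hasDerivAt_quadratic a b c (p 0)) hA).congr_deriv ?_
    simp only [fibreLogDeriv, radialLogDeriv]
    generalize a * p 0 ^ 2 + b * p 0 + c = A at hA ⊢
    generalize b * p 0 + 2 * c = B at hB ⊢
    field_simp
    ring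
  have hm := mderiv_radial (p := p) (M := frameJ a b c)
    (M' := frameJ a b c (p 0) * connCoeff a b c (p 0) 0
      - connCoeff a b c (p 0) 0 * frameJ a b c (p 0)) (by
      intro x y
      fin_cases x <;> fin_cases y <;> simp [frameJ, connCoeff, Matrix.vecMul_diagonal] <;>
        first
        | exact hasDerivAt_const _ _
        | exact (hasDerivAt_const _ _).congr_deriv (by ring)
        | exact hAB.neg.congr_deriv (by ring)
        | exact hBA.congr_deriv (by ring)) i
  have hW := fun d hd => frameJ_comm hc h0 hA hB d hd
  have hR := baseRot_comm_frameJ (a := a) (b := b) (c := c) (p 0)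
  rw [hm]
  obtain rfl | rfl | rfl | rfl : i = 0 ∨ i = 1 ∨ i = 2 ∨ i = 3 := by clear * -; decide +revert
  · rw [if_pos rfl, conn]
    abel
  all_goals
    rw [if_neg (by decide)]
    simp only [conn, horizCorr, smul_zero, add_zero, Matrix.mul_smul, Matrix.smul_mul, add_mul,
      mul_add, sub_mul, mul_sub, neg_mul, mul_neg, hW 1 (by decide), hW 2 (by decide),
      hW 3 (by decide), hR]
    module

theorem mSmoothOn_frameJ : MSmoothOn (fun q => frameJ a b c (q 0)) (abcDomain a b c) := by
  have h1 : ContDiffOn ℝ ∞ (fun q : Fin 4 → ℝ => (a * q 0 ^ 2 + b * q 0 + c) / (b * q 0 + 2 * c))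
      (abcDomain a b c) :=
    contDiffOn_radial (F := fun r => (a * r ^ 2 + b * r + c) / (b * r + 2 * c))
      fun r h0 hA hB => by fun_prop (disch := assumption)
  have h2 : ContDiffOn ℝ ∞ (fun q : Fin 4 → ℝ => (b * q 0 + 2 * c) / (a * q 0 ^ 2 + b * q 0 + c))
      (abcDomain a b c) :=
    contDiffOn_radial (F := fun r => (b * r + 2 * c) / (a * r ^ 2 + b * r + c))
      fun r h0 hA hB => by fun_prop (disch := assumption)
  intro x y
  fin_cases x <;> fin_cases y <;> simp [frameJ] <;>
    first | exact contDiffOn_const | exact h1.neg | exact h2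

theorem riemann_abcMetric (hK : K ≠ 0) {p : Fin 4 → ℝ} (hp : p ∈ abcDomain a b c)
    (l k i j : Fin 4) :
    riemann (abcMetric K a b c) l k i j p =
      (2 / K - weylCoeff K a b c (p 0)) * ((1 : Matrix (Fin 4) (Fin 4) ℝ) l i
          * abcMetric K a b c p k j
        - (1 : Matrix (Fin 4) (Fin 4) ℝ) l j * abcMetric K a b c p k i)
      + weylCoeff K a b c (p 0) *
        ((frame K a b p * frameJ a b c (p 0) * coframe K a b p) l i
          * (abcMetric K a b c p * (frame K a b p * frameJ a b c (p 0) * coframe K a b p)) k j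
        - (frame K a b p * frameJ a b c (p 0) * coframe K a b p) l j
          * (abcMetric K a b c p * (frame K a b p * frameJ a b c (p 0) * coframe K a b p)) k i
        + 2 * ((frame K a b p * frameJ a b c (p 0) * coframe K a b p) l k
          * (abcMetric K a b c p * (frame K a b p * frameJ a b c (p 0) * coframe K a b p)) i j)) :=
  (isMovingFrame hK).riemann_eq hp (conn_curvature hK hp) l k i j

/-- For `b (b² - 4ac) = 0` the metric has constant curvature, and for `c = 0` it has constant
holomorphic sectional curvature. -/
theorem isLocallySymmetricOn_abcMetric (hK : K ≠ 0) (h : b * c * (b ^ 2 - 4 * a * c) = 0) :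
    IsLocallySymmetricOn (abcMetric K a b c) (abcDomain a b c) := by
  have hF := isMovingFrame (a := a) (b := b) (c := c) hK
  by_cases hc : c = 0
  · have hs : MSmoothOn (fun q => frame K a b q * frameJ a b c (q 0) * coframe K a b q)
        (abcDomain a b c) := (mSmoothOn_frame.mul mSmoothOn_frameJ).mul mSmoothOn_coframe
    refine hF.isLocallySymmetricOn hs
      (fun p hp i => hF.mderiv_endomorphism hp mSmoothOn_frameJ i (frameJ_parallel hc hp i))
      (1 / K) (1 / K) fun p hp l k i j => ?_
    have hw : weylCoeff K a b c (p 0) = 1 / K := by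
      obtain ⟨h0, -, hB, -⟩ := hp
      subst hc
      have hb : b ≠ 0 := by
        rintro rfl
        simp at hB
      have := h0.ne'
      unfold weylCoeff
      simp only [mul_zero, sub_zero, add_zero]
      field_simp
    rw [riemann_abcMetric hK hp, hw]
    ring
  · have hw : ∀ r, weylCoeff K a b c r = 0 := by
      intro r
      have : b * (b ^ 2 - 4 * a * c) = 0 := by
        rcases mul_eq_zero.1 (by linear_combination h : c * (b * (b ^ 2 - 4 * a * c)) = 0) with h | h
        · exact absurd h hc
        · exact h
      rw [weylCoeff, this, zero_mul, zero_div]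
    refine hF.isLocallySymmetricOn (J := fun _ => 0) (fun _ _ => contDiffOn_const)
      (fun p hp i => by rw [mderiv_const, Matrix.zero_mul, Matrix.mul_zero, sub_zero])
      (2 / K) 0 fun p hp l k i j => ?_
    rw [riemann_abcMetric hK hp, hw]
    ring

/-! ### Killing fields are tangent to the hypersurfaces of constant `ρ` -/

section Tangent

variable {V : Set (Fin 4 → ℝ)} {X : (Fin 4 → ℝ) → (Fin 4 → ℝ)}

theorem smooth_component (hX : ContDiffOn ℝ ∞ X V) (k : Fin 4) :
    ContDiffOn ℝ ∞ (fun q => X q k) V :=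
  contDiffOn_pi.1 hX k

theorem abcMetric_zero_left (q : Fin 4 → ℝ) (k : Fin 4) :
    abcMetric K a b c q 0 k = if k = 0 then radialCoeff K a b c (q 0) else 0 := by
  fin_cases k <;> simp [abcMetric, abcForm, radialCoeff]

theorem abcMetric_zero_right (q : Fin 4 → ℝ) (k : Fin 4) :
    abcMetric K a b c q k 0 = if k = 0 then radialCoeff K a b c (q 0) else 0 := by
  fin_cases k <;> simp [abcMetric, abcForm, radialCoeff]

theorem abcMetric_three_right (q : Fin 4 → ℝ) (k : Fin 4) :
    abcMetric K a b c q k 3 = -(fibreCoeff K a b c (q 0) / K) * coframe K a b q 3 k := by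
  fin_cases k <;> simp [abcMetric, abcForm, fibreCoeff, coframe, conf] <;> ring

theorem abcMetric_three_left (q : Fin 4 → ℝ) (k : Fin 4) :
    abcMetric K a b c q 3 k = -(fibreCoeff K a b c (q 0) / K) * coframe K a b q 3 k := by
  fin_cases k <;> simp [abcMetric, abcForm, fibreCoeff, coframe, conf] <;> ring

variable (K a b) in
/-- The function `θ(X)`. -/
def fibrePart (X : (Fin 4 → ℝ) → (Fin 4 → ℝ)) (q : Fin 4 → ℝ) : ℝ :=
  ∑ k, coframe K a b q 3 k * X q k

theorem smooth_fibrePart (hVU : V ⊆ abcDomain a b c) (hX : ContDiffOn ℝ ∞ X V) :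
    ContDiffOn ℝ ∞ (fibrePart K a b X) V :=
  ContDiffOn.sum fun k _ => ((mSmoothOn_coframe 3 k).mono hVU).mul (smooth_component hX k)

theorem pderiv_fibrePart (hV : IsOpen V) (hVU : V ⊆ abcDomain a b c) (hX : ContDiffOn ℝ ∞ X V)
    {p : Fin 4 → ℝ} (hp : p ∈ V) {i : Fin 4} (hi : mderiv i (coframe K a b) p = 0) :
    pderiv i (fibrePart K a b X) p
      = ∑ k, coframe K a b p 3 k * pderiv i (fun q => X q k) p := by
  have h1 := fun k => differentiableAt_of_smooth isOpen_abcDomain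
    (mSmoothOn_coframe (K := K) (a := a) (b := b) (c := c) 3 k) (hVU hp)
  have h2 := fun k => differentiableAt_of_smooth hV (smooth_component hX k) hp
  unfold fibrePart
  rw [pderiv_sum fun k _ => (h1 k).fun_mul (h2 k)]
  refine Finset.sum_congr rfl fun k _ => ?_
  have h3 : pderiv i (fun q => coframe K a b q 3 k) p = 0 := congrFun (congrFun hi 3) k
  rw [pderiv_mul (h1 k) (h2 k), h3]
  ring

/-- The components of the Killing equation along the surfaces spanned by `∂_ρ` and `∂_t`. They
involve only `u = dρ(X)` and `τ = θ(X)`. -/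
theorem killing_equations (hK : K ≠ 0) (hV : IsOpen V) (hVU : V ⊆ abcDomain a b c)
    (hX : IsKillingOn (abcMetric K a b c) V X) {p : Fin 4 → ℝ} (hp : p ∈ V) :
    pderiv 0 (fun q => X q 0) p = -radialLogDeriv a b c (p 0) * X p 0 ∧
    pderiv 3 (fibrePart K a b X) p = fibreLogDeriv a b c (p 0) * X p 0 / K ∧
    pderiv 0 (fibrePart K a b X) p
      = K * ((b * p 0 + 2 * c) / (a * p 0 ^ 2 + b * p 0 + c)) ^ 2
        * pderiv 3 (fun q => X q 0) p := by
  obtain ⟨h0, hA, hB, -⟩ := hVU hp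
  replace h0 := h0.ne'
  replace hA := hA.ne'
  obtain ⟨d0, -, -, d3⟩ := mderiv_coframe (K := K) (hVU hp)
  have t0 := pderiv_fibrePart hV hVU hX.1 hp d0
  have t3 := pderiv_fibrePart hV hVU hX.1 hp d3
  have e00 := hX.2 p hp 0 0
  have e33 := hX.2 p hp 3 3
  have e03 := hX.2 p hp 0 3
  have g00 : (fun q => abcMetric K a b c q 0 0) = fun q => radialCoeff K a b c (q 0) := by
    ext q; simp [abcMetric_zero_left]
  have g03 : (fun q => abcMetric K a b c q 0 3) = fun q => 0 := by
    ext q; simp [abcMetric_zero_left]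
  have g33 : (fun q => abcMetric K a b c q 3 3) = fun q => fibreCoeff K a b c (q 0) / K ^ 2 := by
    ext q
    rw [abcMetric_three_left]
    simp [coframe]
    ring
  have hr : radialCoeff K a b c (p 0) ≠ 0 := by simp [radialCoeff, *]
  have hf : fibreCoeff K a b c (p 0) ≠ 0 := by simp [fibreCoeff, *]
  have hratio : radialCoeff K a b c (p 0) = fibreCoeff K a b c (p 0)
      * ((b * p 0 + 2 * c) / (a * p 0 ^ 2 + b * p 0 + c)) ^ 2 := by
    unfold radialCoeff fibreCoeff
    field_simp
  have p00 : ∀ i, pderiv i (fun q => radialCoeff K a b c (q 0)) p = _ :=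
    pderiv_radial (hasDerivAt_radialCoeff h0 hA hB)
  have p33 : ∀ i, pderiv i (fun q => fibreCoeff K a b c (q 0) / K ^ 2) p = _ :=
    pderiv_radial ((hasDerivAt_fibreCoeff h0 hA hB).div_const (K ^ 2))
  simp only [lieDerivMetric, g00, g03, g33, p00, p33, pderiv_const] at e00 e33 e03
  simp only [abcMetric_zero_left, abcMetric_zero_right, abcMetric_three_left,
    abcMetric_three_right, Finset.sum_add_distrib, mul_assoc, ← Finset.mul_sum, ← t0, ← t3,
    ite_mul, zero_mul, mul_ite, mul_zero, Finset.sum_ite_eq', Finset.mem_univ,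
    if_true, zero_add] at e00 e33 e03
  generalize ((b * p 0 + 2 * c) / (a * p 0 ^ 2 + b * p 0 + c)) ^ 2 = ψ at *
  refine ⟨?_, ?_, ?_⟩
  · apply mul_left_cancel₀ hr
    linear_combination e00 / 2
  · rw [eq_div_iff hK]
    apply mul_left_cancel₀ hf
    field_simp at e33
    linear_combination -e33 / 2
  · apply mul_left_cancel₀ hf
    rw [hratio] at e03
    field_simp at e03
    linear_combination -e03

variable (a b c) in
/-- The function `G = (h₃ / h₀) ((h₃' / 2h₃)' - (h₀' / 2h₀) (h₃' / 2h₃))` of `ρ`, with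
`h₀ = radialCoeff` and `h₃ = fibreCoeff`. It occurs in the equation `∂_t² u = G u / K²` for the
component `u = dρ(X)` of a Killing field `X`. -/
def gaussTerm (r : ℝ) : ℝ :=
  -(b ^ 2 - 4 * a * c) / 4 * (1 / (b * r + 2 * c) ^ 2)
    + 3 * b ^ 2 / 4 * ((a * r ^ 2 + b * r + c) ^ 2 / (b * r + 2 * c) ^ 4)
    - b / 2 * ((2 * a * r + b) * (a * r ^ 2 + b * r + c) / (b * r + 2 * c) ^ 3)

theorem hasDerivAt_gaussTerm {r : ℝ} (hB : b * r + 2 * c ≠ 0) :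
    HasDerivAt (gaussTerm a b c)
      (3 * (a * r ^ 2 + b * r + c) * (b * c * (b ^ 2 - 4 * a * c)) / (b * r + 2 * c) ^ 5) r := by
  have hq := hasDerivAt_quadratic a b c r
  have hl := hasDerivAt_linear b c r
  have hl' := hasDerivAt_linear (2 * a) (b / 2) r
  refine ((((hasDerivAt_const r (1 : ℝ)).div (hl.pow 2) (pow_ne_zero 2 hB)).const_mul
      (-(b ^ 2 - 4 * a * c) / 4)).add
    (((hq.pow 2).div (hl.pow 4) (pow_ne_zero 4 hB)).const_mul (3 * b ^ 2 / 4))).sub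
    (((hl'.mul hq).div (hl.pow 3) (pow_ne_zero 3 hB)).const_mul (b / 2))
    |>.congr_of_eventuallyEq (.of_forall fun x => ?_) |>.congr_deriv ?_
  · simp only [gaussTerm, Pi.add_apply, Pi.sub_apply, Pi.mul_apply, Pi.div_apply, Pi.pow_apply]
    ring
  · simp
    field_simp
    ring

theorem gaussTerm_eq {r : ℝ} (h0 : r ≠ 0) (hA : a * r ^ 2 + b * r + c ≠ 0)
    (hB : b * r + 2 * c ≠ 0) :
    ((b * r + 2 * c) / (a * r ^ 2 + b * r + c)) ^ 2 * gaussTerm a b c r =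
      (2 * a / (a * r ^ 2 + b * r + c) - (2 * a * r + b) ^ 2 / (a * r ^ 2 + b * r + c) ^ 2
        + b ^ 2 / (b * r + 2 * c) ^ 2 + 2 / r ^ 2) / 2
        - radialLogDeriv a b c r * fibreLogDeriv a b c r := by
  unfold gaussTerm radialLogDeriv fibreLogDeriv
  generalize hAe : a * r ^ 2 + b * r + c = A at hA ⊢
  generalize hBe : b * r + 2 * c = B at hB ⊢
  field_simp
  subst hAe hBe
  ring1

/-- If `b c (b² - 4ac) ≠ 0`, then `dρ(X) = 0` for every local Killing field `X`. Write `u = dρ(X)`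
and `τ = θ(X)`. Equality of the mixed derivatives of `τ` gives `∂_t² u = G(ρ) u / K²` with
`G = gaussTerm`, and equality of the mixed derivatives of `∂_t u` then gives `G' u = 0`. -/
theorem killing_tangent (hK : K ≠ 0) (habc : b * c * (b ^ 2 - 4 * a * c) ≠ 0) (hV : IsOpen V)
    (hVU : V ⊆ abcDomain a b c) (hX : IsKillingOn (abcMetric K a b c) V X) {p : Fin 4 → ℝ}
    (hp : p ∈ V) : X p 0 = 0 := by
  have hu := smooth_component hX.1 0
  have hτ := smooth_fibrePart (K := K) hVU hX.1
  have hdu : ∀ q ∈ V, DifferentiableAt ℝ (fun q => X q 0) q :=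
    fun q hq => differentiableAt_of_smooth hV hu hq
  have hcoord : ∀ {F : ℝ → ℝ} {F' : ℝ} {q : Fin 4 → ℝ}, HasDerivAt F F' (q 0) →
      DifferentiableAt ℝ (fun q : Fin 4 → ℝ => F (q 0)) q := fun {_ _ q} h =>
    h.differentiableAt.comp q (differentiableAt_apply 0 q)
  have hru : ∀ {F : ℝ → ℝ} {F' : ℝ} {f : (Fin 4 → ℝ) → ℝ} {q : Fin 4 → ℝ} (i : Fin 4),
      HasDerivAt F F' (q 0) → DifferentiableAt ℝ f q →
      pderiv i (fun q => F (q 0) * f q) q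
        = (if i = 0 then F' else 0) * f q + F (q 0) * pderiv i f q := by
    intro F F' f q i hF hf
    rw [pderiv_mul (hcoord hF) hf, pderiv_radial hF]
  have hrad : ∀ q ∈ V, ∃ d, HasDerivAt (radialLogDeriv a b c) d (q 0) := by
    intro q hq
    obtain ⟨h0, hA, hB, -⟩ := hVU hq
    exact ⟨_, hasDerivAt_connCoeff h0.ne' hA.ne' hB 0 0 0⟩
  -- the second `t`-derivative of `u`
  have hu33 : ∀ q ∈ V, pderiv 3 (pderiv 3 fun q => X q 0) q
      = 1 / K ^ 2 * (gaussTerm a b c (q 0) * X q 0) := by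
    intro q hq
    obtain ⟨h0, hA, hB, -⟩ := hVU hq
    have h0 := h0.ne'
    have hA := hA.ne'
    have hd3 : DifferentiableAt ℝ (pderiv 3 fun q => X q 0) q :=
      differentiableAt_of_smooth hV (contDiffOn_pderiv hV hu) hq
    have hcomm := pderiv_comm (i := 0) (j := 3) hV hτ hq
    have hf := hasDerivAt_fibreLogDeriv h0 hA hB
    have hψ : HasDerivAt (fun r => ((b * r + 2 * c) / (a * r ^ 2 + b * r + c)) ^ 2) _ (q 0) :=
      ((hasDerivAt_linear b c (q 0)).div (hasDerivAt_quadratic a b c (q 0)) hA).pow 2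
    rw [pderiv_congr (h := fun q => 1 / K * (fibreLogDeriv a b c (q 0) * X q 0)) hV
        (fun q hq => by rw [(killing_equations hK hV hVU hX hq).2.1]; ring) hq,
      pderiv_congr (i := 3) (h := fun q => K * (((b * q 0 + 2 * c)
        / (a * q 0 ^ 2 + b * q 0 + c)) ^ 2 * pderiv 3 (fun q => X q 0) q)) hV
        (fun q hq => by rw [(killing_equations hK hV hVU hX hq).2.2]; ring) hq,
      pderiv_const_mul _ ((hcoord hf).fun_mul (hdu q hq)),
      pderiv_const_mul _ ((hcoord hψ).fun_mul hd3), hru 0 hf (hdu q hq), hru 3 hψ hd3,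
      if_pos rfl, if_neg (by decide), (killing_equations hK hV hVU hX hq).1] at hcomm
    have hG := gaussTerm_eq h0 hA hB
    have hψ0 : ((b * q 0 + 2 * c) / (a * q 0 ^ 2 + b * q 0 + c)) ^ 2 ≠ 0 :=
      pow_ne_zero 2 (div_ne_zero hB hA)
    apply mul_left_cancel₀ (mul_ne_zero hK hψ0)
    have hK2 : K * (1 / K ^ 2) = 1 / K := by field_simp
    linear_combination -hcomm - (1 / K) * X q 0 * hG
      - ((b * q 0 + 2 * c) / (a * q 0 ^ 2 + b * q 0 + c)) ^ 2 * gaussTerm a b c (q 0) * X q 0 * hK2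
  obtain ⟨h0, hA, hB, -⟩ := hVU hp
  obtain ⟨ℓ', hℓ⟩ := hrad p hp
  have hG := hasDerivAt_gaussTerm (a := a) hB
  -- compare the two expressions for `∂_ρ ∂_t² u`
  have h1 : pderiv 0 (pderiv 3 (pderiv 3 fun q => X q 0)) p
      = -radialLogDeriv a b c (p 0) * pderiv 3 (pderiv 3 fun q => X q 0) p := by
    have h3 : ∀ q ∈ V, pderiv 0 (pderiv 3 fun q => X q 0) q
        = -radialLogDeriv a b c (q 0) * pderiv 3 (fun q => X q 0) q := by
      intro q hq
      obtain ⟨m, hm⟩ := hrad q hq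
      rw [pderiv_comm hV hu hq, pderiv_congr (h := fun q => -radialLogDeriv a b c (q 0) * X q 0) hV
        (fun q hq => (killing_equations hK hV hVU hX hq).1) hq,
        hru (F := fun r => -radialLogDeriv a b c r) 3 hm.neg (hdu q hq), if_neg (by decide)]
      ring
    rw [pderiv_comm hV (contDiffOn_pderiv hV hu) hp, pderiv_congr hV h3 hp,
      hru (F := fun r => -radialLogDeriv a b c r) 3 hℓ.neg
        (differentiableAt_of_smooth hV (contDiffOn_pderiv hV hu) hp), if_neg (by decide)]
    ring
  rw [pderiv_congr hV hu33 hp, hu33 p hp,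
    pderiv_const_mul _ ((hcoord hG).fun_mul (hdu p hp)), hru 0 hG (hdu p hp), if_pos rfl,
    (killing_equations hK hV hVU hX hp).1] at h1
  have h2 : 3 * (a * p 0 ^ 2 + b * p 0 + c) * (b * c * (b ^ 2 - 4 * a * c))
      / (b * p 0 + 2 * c) ^ 5 * X p 0 = 0 := by
    have : 1 / K ^ 2 ≠ 0 := one_div_ne_zero (pow_ne_zero 2 hK)
    apply mul_left_cancel₀ this
    linear_combination h1
  refine (mul_eq_zero.1 h2).resolve_left (div_ne_zero ?_ (pow_ne_zero 5 hB))
  exact mul_ne_zero (mul_ne_zero three_ne_zero hA.ne') habc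

end Tangent

/-! ### The Killing fields that preserve the hypersurfaces of constant `ρ` -/

variable (K a b) in
/-- For `v = (α, β, γ, δ)`, the vector field whose flow is given by
`ζ' = α + β i + γ i ζ + (a/2) (α - β i) ζ²` and `t' = δ - K b Im ((α - β i) ζ)`, with `ρ` constant.
The first equation is that of an infinitesimal isometry of the base surface with metric
`|dζ|² / (1 + (a/2)|ζ|²)²`; the second one is its lift. -/
def killingField : (Fin 4 → ℝ) →ₗ[ℝ] ((Fin 4 → ℝ) → (Fin 4 → ℝ)) where
  toFun v p := ![0,
    v 0 * (1 + a / 2 * (p 1 ^ 2 - p 2 ^ 2)) + v 1 * (a * p 1 * p 2) - v 2 * p 2,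
    v 0 * (a * p 1 * p 2) + v 1 * (1 - a / 2 * (p 1 ^ 2 - p 2 ^ 2)) + v 2 * p 1,
    -(v 0 * (K * b * p 2)) + v 1 * (K * b * p 1) + v 3]
  map_add' v w := by
    ext p k
    fin_cases k <;> simp <;> ring
  map_smul' r v := by
    ext p k
    fin_cases k <;> simp <;> ring

theorem killingField_apply (v p : Fin 4 → ℝ) : killingField K a b v p = ![0,
    v 0 * (1 + a / 2 * (p 1 ^ 2 - p 2 ^ 2)) + v 1 * (a * p 1 * p 2) - v 2 * p 2,
    v 0 * (a * p 1 * p 2) + v 1 * (1 - a / 2 * (p 1 ^ 2 - p 2 ^ 2)) + v 2 * p 1,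
    -(v 0 * (K * b * p 2)) + v 1 * (K * b * p 1) + v 3] := rfl

variable (K a b) in
/-- The Jacobian matrix of `killingField`. -/
def killingJacobian (v p : Fin 4 → ℝ) : Matrix (Fin 4) (Fin 4) ℝ :=
  !![0, 0, 0, 0;
    0, a * (v 0 * p 1 + v 1 * p 2), a * (v 1 * p 1 - v 0 * p 2) - v 2, 0;
    0, v 2 - a * (v 1 * p 1 - v 0 * p 2), a * (v 0 * p 1 + v 1 * p 2), 0;
    0, K * b * v 1, -(K * b * v 0), 0]

theorem hasFDerivAt_killingField (v p : Fin 4 → ℝ) : HasFDerivAt (killingField K a b v)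
    (LinearMap.toContinuousLinearMap (Matrix.toLin' (killingJacobian K a b v p))) p := by
  have hx := hasFDerivAt_apply (𝕜 := ℝ) (1 : Fin 4) p
  have hy := hasFDerivAt_apply (𝕜 := ℝ) (2 : Fin 4) p
  have quad : ∀ k₀ k₁ k₂ k₃ k₄ : ℝ, HasFDerivAt
      (fun q : Fin 4 → ℝ => k₁ * q 1 + k₂ * q 2 + k₃ * (q 1 ^ 2 - q 2 ^ 2) + k₄ * (q 1 * q 2) + k₀)
      _ p := fun k₀ k₁ k₂ k₃ k₄ =>
    ((((hx.const_mul k₁).add (hy.const_mul k₂)).add (((hx.pow 2).sub (hy.pow 2)).const_mul k₃)).add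
      ((hx.mul hy).const_mul k₄)).add_const k₀
  refine hasFDerivAt_pi'' fun k => ?_
  fin_cases k
  · refine (hasFDerivAt_const (0 : ℝ) p).congr_fderiv ?_
    ext w
    simp [killingJacobian, dotProduct, Fin.sum_univ_four]
  · refine ((quad (v 0) 0 (-v 2) (v 0 * (a / 2)) (v 1 * a)).congr_of_eventuallyEq
      (.of_forall fun q => ?_)).congr_fderiv ?_
    · simp [killingField_apply]; ring
    · ext w
      simp [killingJacobian, dotProduct, Fin.sum_univ_four]
      ring
  · refine ((quad (v 1) (v 2) 0 (-v 1 * (a / 2)) (v 0 * a)).congr_of_eventuallyEq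
      (.of_forall fun q => ?_)).congr_fderiv ?_
    · simp [killingField_apply]; ring
    · ext w
      simp [killingJacobian, dotProduct, Fin.sum_univ_four]
      ring
  · refine ((quad (v 3) (K * b * v 1) (-(K * b * v 0)) 0 0).congr_of_eventuallyEq
      (.of_forall fun q => ?_)).congr_fderiv ?_
    · simp [killingField_apply]; ring
    · ext w
      simp [killingJacobian, dotProduct, Fin.sum_univ_four]

theorem pderiv_killingField (v p : Fin 4 → ℝ) (i k : Fin 4) :
    pderiv i (fun q => killingField K a b v q k) p = killingJacobian K a b v p k i := by
  unfold pderiv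
  rw [(hasFDerivAt_pi'.1 (hasFDerivAt_killingField v p) k).fderiv]
  simp

theorem contDiff_killingField (v : Fin 4 → ℝ) : ContDiff ℝ ∞ (killingField K a b v) := by
  rw [contDiff_pi]
  intro k
  simp only [killingField_apply]
  fin_cases k <;> simp <;> fun_prop

/-- The coframe is preserved by the field up to a rotation of the base directions. -/
theorem lieDeriv_coframe (hK : K ≠ 0) (v : Fin 4 → ℝ) {p : Fin 4 → ℝ}
    (hp : p ∈ abcDomain a b c) :
    ∑ k, killingField K a b v p k • mderiv k (coframe K a b) p
      + coframe K a b p * killingJacobian K a b v p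
      = (a * (v 1 * p 1 - v 0 * p 2) - v 2) • (baseRot * coframe K a b p) := by
  obtain ⟨d0, d1, d2, d3⟩ := mderiv_coframe (K := K) hp
  have hD := conf_ne_zero hp
  have hD' : a * (p 1 ^ 2 + p 2 ^ 2) = 2 * conf a p - 2 := by unfold conf; ring
  rw [Fin.sum_univ_four, d0, d1, d2, d3]
  generalize hDe : conf a p = D at *
  ext i j
  simp only [killingField_apply, baseRot, killingJacobian, Matrix.add_apply, Matrix.smul_apply,
    Matrix.mul_apply, Fin.sum_univ_four]
  fin_cases i <;> fin_cases j <;> simp [coframe, hDe] <;> field_simp <;>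
    first
    | done
    | ring1
    | linear_combination -(a * (v 0 * p 1 + v 1 * p 2)) * hD'
    | linear_combination b * (v 1 * (D - a * p 2 ^ 2) - a * v 0 * p 1 * p 2) * hD'
    | linear_combination b * (a * v 1 * p 1 * p 2 - v 0 * (D - a * p 1 ^ 2)) * hD'

theorem isKillingOn_killingField (hK : K ≠ 0) (v : Fin 4 → ℝ) :
    IsKillingOn (abcMetric K a b c) (abcDomain a b c) (killingField K a b v) := by
  refine ⟨(contDiff_killingField v).contDiffOn, fun p hp i j => ?_⟩
  have hU := isOpen_abcDomain (a := a) (b := b) (c := c)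
  have hm : ∀ k, killingField K a b v p k • mderiv k (abcMetric K a b c) p
      = (killingField K a b v p k • mderiv k (coframe K a b) p)ᵀ * gram K a b c p * coframe K a b p
        + (coframe K a b p)ᵀ * gram K a b c p
          * (killingField K a b v p k • mderiv k (coframe K a b) p) := by
    intro k
    have he := mSmoothOn_coframe (K := K) (a := a) (b := b) (c := c)
    have hη := mSmoothOn_gram (K := K) (a := a) (b := b) (c := c)
    have h0 : killingField K a b v p k • mderiv k (gram K a b c) p = 0 := by
      rw [mderiv_gram hp]
      split_ifs with hk
      · subst hk
        exact zero_smul ℝ _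
      · exact smul_zero _
    rw [funext (abcMetric_eq (K := K) (a := a) (b := b) (c := c)),
      mderiv_mul hU (he.transpose.mul hη) he hp, mderiv_mul hU he.transpose hη hp,
      mderiv_transpose]
    generalize killingField K a b v p k = x at *
    simp only [add_mul, smul_add, Matrix.transpose_smul, Matrix.smul_mul, Matrix.mul_smul]
    have h1 : x • ((coframe K a b p)ᵀ * mderiv k (gram K a b c) p * coframe K a b p) = 0 := by
      rw [← Matrix.smul_mul, ← Matrix.mul_smul, h0, Matrix.mul_zero, Matrix.zero_mul]
    rw [h1, add_zero]
  have hsum : lieDerivMetric (abcMetric K a b c) (killingField K a b v) i j p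
      = (∑ k, killingField K a b v p k • mderiv k (abcMetric K a b c) p
        + (killingJacobian K a b v p)ᵀ * abcMetric K a b c p
        + abcMetric K a b c p * killingJacobian K a b v p) i j := by
    simp only [lieDerivMetric, pderiv_killingField, Finset.sum_add_distrib, Matrix.add_apply,
      Matrix.sum_apply, Matrix.smul_apply, Matrix.mul_apply, Matrix.transpose_apply, smul_eq_mul,
      mderiv, Matrix.of_apply, mul_comm]
  have hS := lieDeriv_coframe hK v hp
  rw [hsum, Finset.sum_congr rfl fun k _ => hm k, Finset.sum_add_distrib, ← Finset.sum_mul,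
    ← Finset.sum_mul, ← Matrix.transpose_sum, ← Finset.mul_sum, eq_sub_of_add_eq hS, abcMetric_eq]
  have hR := baseRot_skew (K := K) (a := a) (b := b) (c := c) p
  generalize a * (v 1 * p 1 - v 0 * p 2) - v 2 = f
  have h0 : f • ((coframe K a b p)ᵀ * (baseRotᵀ * gram K a b c p + gram K a b c p * baseRot)
      * coframe K a b p) = 0 := by
    rw [hR, Matrix.mul_zero, Matrix.zero_mul, smul_zero]
  refine congrFun (congrFun (Eq.trans ?_ h0) i) j
  simp only [Matrix.transpose_sub, Matrix.transpose_mul, Matrix.transpose_smul, sub_mul, mul_sub,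
    add_mul, mul_add, Matrix.smul_mul, Matrix.mul_smul, smul_add, ← Matrix.mul_assoc]
  abel

variable (K a b) in
/-- The Lie bracket of `killingField`, in terms of the parameters. -/
def killingBracket (v w : Fin 4 → ℝ) : Fin 4 → ℝ :=
  ![v 2 * w 1 - v 1 * w 2, v 0 * w 2 - v 2 * w 0, -(2 * a * (v 0 * w 1 - v 1 * w 0)),
    2 * K * b * (v 0 * w 1 - v 1 * w 0)]

theorem killingField_killingBracket (v w p : Fin 4 → ℝ) :
    killingField K a b (killingBracket K a b v w) p
      = VectorField.lieBracket ℝ (killingField K a b v) (killingField K a b w) p := by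
  rw [VectorField.lieBracket, (hasFDerivAt_killingField v p).fderiv,
    (hasFDerivAt_killingField w p).fderiv]
  ext k
  fin_cases k <;>
    simp [killingField_apply, killingBracket, killingJacobian] <;> ring1

/-- The fields `killingField` are transitive on the hypersurfaces of constant `ρ`. -/
theorem exists_killingField_eq {p : Fin 4 → ℝ} (hp : p ∈ abcDomain a b c) {u : Fin 4 → ℝ}
    (hu : u 0 = 0) : ∃ v, killingField K a b v p = u := by
  have hD := conf_ne_zero hp
  -- `γ` is chosen so that the terms of the first equation that are not multiples of `D` cancel
  refine ⟨![u 1 / conf a p, u 2 / conf a p, a / conf a p * (u 2 * p 1 - u 1 * p 2),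
    u 3 + K * b * (u 1 / conf a p * p 2 - u 2 / conf a p * p 1)], ?_⟩
  have hD' : a * (p 1 ^ 2 + p 2 ^ 2) = 2 * conf a p - 2 := by unfold conf; ring
  generalize conf a p = D at *
  ext k
  fin_cases k <;> simp [killingField_apply, hu]
  · field_simp
    linear_combination u 1 * hD'
  · field_simp
    linear_combination u 2 * hD'
  · ring

/-- The action is effective: the values of the field at `ζ = 0` determine `α`, `β` and `δ`, and its
value at another point gives `γ`. -/
theorem eq_zero_of_killingField_eq_zero {p : Fin 4 → ℝ} (hp : p ∈ abcDomain a b c)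
    {v : Fin 4 → ℝ} (hv : ∀ q ∈ abcDomain a b c, q 0 = p 0 → killingField K a b v q = 0) :
    v = 0 := by
  obtain ⟨h0, hA, hB, -⟩ := hp
  -- the point `ζ = 1 / (1 + |a|)` is close enough to `0` to satisfy `1 + (a/2)|ζ|² > 0`
  have hh : 0 < 1 / (1 + |a|) := by positivity
  have h1 := hv ![p 0, 0, 0, 0] (by simpa [abcDomain] using ⟨h0, hA, hB⟩) rfl
  have h2 := hv ![p 0, 1 / (1 + |a|), 0, 0] (by
    refine ⟨h0, hA, hB, ?_⟩
    have : |a / 2 * (1 / (1 + |a|)) ^ 2| < 1 := by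
      rw [abs_mul, abs_div, abs_of_pos (pow_pos hh 2), abs_two, div_pow, one_pow,
        div_mul_div_comm, mul_one, div_lt_one (by positivity)]
      nlinarith [abs_nonneg a]
    simpa using neg_lt_iff_pos_add'.1 (abs_lt.1 this).1) rfl
  have e0 : v 0 = 0 := by simpa [killingField_apply] using congrFun h1 1
  have e1 : v 1 = 0 := by simpa [killingField_apply] using congrFun h1 2
  have e3 : v 3 = 0 := by simpa [killingField_apply] using congrFun h1 3
  have e2 : v 2 * (1 / (1 + |a|)) = 0 := by
    simpa [killingField_apply, e0, e1] using congrFun h2 2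
  ext k
  fin_cases k
  exacts [e0, e1, (mul_eq_zero.1 e2).resolve_right hh.ne', e3]

theorem fderiv_coord_zero (p v : Fin 4 → ℝ) : fderiv ℝ (fun p : Fin 4 → ℝ => p 0) p v = v 0 := by
  rw [(hasFDerivAt_apply (𝕜 := ℝ) (0 : Fin 4) p).fderiv]
  rfl

/-- A Lie algebra with structure constants `killingBracket` acts through `killingField`. -/
theorem isTransitiveKillingActionOnLevels (hK : K ≠ 0) {𝔤 : Type*} [LieRing 𝔤] [LieAlgebra ℝ 𝔤]
    (L : 𝔤 →ₗ[ℝ] (Fin 4 → ℝ)) (hinj : ∀ ξ, L ξ = 0 → ξ = 0) (hsurj : Function.Surjective L)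
    (hbr : ∀ ξ η, L ⁅ξ, η⁆ = killingBracket K a b (L ξ) (L η)) :
    IsTransitiveKillingActionOnLevels (abcMetric K a b c) (abcDomain a b c) (fun p => p 0)
      (killingField K a b ∘ₗ L) where
  killing ξ := isKillingOn_killingField hK (L ξ)
  map_lie ξ η p _ := by
    rw [LinearMap.comp_apply, hbr, killingField_killingBracket]
    rfl
  tangent ξ p _ := fderiv_coord_zero _ _
  transitive p hp u hu := by
    rw [fderiv_coord_zero] at hu
    obtain ⟨v, rfl⟩ := exists_killingField_eq (K := K) hp hu
    obtain ⟨ξ, rfl⟩ := hsurj v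
    exact ⟨ξ, rfl⟩
  effective p hp ξ hξ := hinj ξ (eq_zero_of_killingField_eq_zero hp hξ)

/-! ### Cohomogeneity -/

theorem orbitTangent_abcMetric (hK : K ≠ 0) (habc : b * c * (b ^ 2 - 4 * a * c) ≠ 0)
    {p : Fin 4 → ℝ} (hp : p ∈ abcDomain a b c) :
    orbitTangent (abcMetric K a b c) (abcDomain a b c) p
      = LinearMap.ker (LinearMap.proj (R := ℝ) (φ := fun _ : Fin 4 => ℝ) 0) := by
  apply le_antisymm
  · rw [orbitTangent, Submodule.span_le]
    rintro _ ⟨V, hV, hVU, hpV, X, hX, rfl⟩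
    exact killing_tangent hK habc hV hVU hX hpV
  · intro u hu
    obtain ⟨v, hv⟩ := exists_killingField_eq (K := K) hp hu
    exact Submodule.subset_span ⟨abcDomain a b c, isOpen_abcDomain, le_rfl, hp,
      killingField K a b v, isKillingOn_killingField hK v, hv⟩

theorem cohomogeneityAt_abcMetric (hK : K ≠ 0) (habc : b * c * (b ^ 2 - 4 * a * c) ≠ 0)
    {p : Fin 4 → ℝ} (hp : p ∈ abcDomain a b c) :
    cohomogeneityAt (abcMetric K a b c) (abcDomain a b c) p = 1 := by
  rw [cohomogeneityAt, orbitTangent_abcMetric hK habc hp,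
    (LinearMap.quotKerEquivOfSurjective _ (LinearMap.proj_surjective 0)).finrank_eq,
    Module.finrank_self]

/-! ### The Lie algebras of Killing fields -/

section LieAlgebras

attribute [local instance 100] LieRing.ofAssociativeRing

theorem so_two_eq (A : LieAlgebra.Orthogonal.so (Fin 2) ℝ) :
    (A : Matrix (Fin 2) (Fin 2) ℝ) = !![0, -A.1 1 0; A.1 1 0, 0] := by
  have hA := (LieAlgebra.Orthogonal.mem_so (Fin 2) ℝ _).1 A.2
  have h00 := congrFun (congrFun hA 0) 0
  have h01 := congrFun (congrFun hA 0) 1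
  have h11 := congrFun (congrFun hA 1) 1
  simp only [Matrix.transpose_apply, Matrix.neg_apply] at h00 h01 h11
  ext i j
  fin_cases i <;> fin_cases j <;> simp <;> linarith

variable (K b) in
/-- The isomorphism of `𝔬(2) ⋉ 𝔥𝔢𝔦𝔰₃(ℝ)` with the Lie algebra of the parameters of `killingField` for
`a = 0`. -/
def o2Heis3Param : O2Heis3 →ₗ[ℝ] (Fin 4 → ℝ) where
  toFun ξ := ![ξ.left.v 0, ξ.left.v 1, -ξ.right.1 1 0, 2 * K * b * ξ.left.z]
  map_add' ξ η := by
    ext k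
    fin_cases k <;> simp [LieAlgebra.SemiDirectSum.add_eq_mk] <;> ring
  map_smul' r ξ := by
    ext k
    fin_cases k <;> (simp [LieAlgebra.SemiDirectSum.smul_eq_mk]; try ring)

theorem o2Heis3Param_apply (ξ : O2Heis3) : o2Heis3Param K b ξ
    = ![ξ.left.v 0, ξ.left.v 1, -ξ.right.1 1 0, 2 * K * b * ξ.left.z] := rfl

theorem o2Heis3Param_lie (ξ η : O2Heis3) : o2Heis3Param K b ⁅ξ, η⁆
    = killingBracket K 0 b (o2Heis3Param K b ξ) (o2Heis3Param K b η) := by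
  obtain ⟨x, A⟩ := ξ
  obtain ⟨y, B⟩ := η
  have hrot : ∀ A y, Heis3.rotation A y = ⟨A.1 *ᵥ y.v, 0⟩ := fun _ _ => rfl
  have hA := so_two_eq A
  have hB := so_two_eq B
  have hAB : (⁅A, B⁆ : LieAlgebra.Orthogonal.so (Fin 2) ℝ).1 1 0 = 0 := by
    rw [LieSubalgebra.coe_bracket, LieRing.of_associative_ring_bracket, hA, hB]
    simp
  rw [LieAlgebra.SemiDirectSum.lie_eq_mk]
  simp only [o2Heis3Param_apply, hrot, hAB]
  rw [hA, hB]
  ext k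
  fin_cases k <;> simp [killingBracket, Matrix.vecHead, Matrix.vecTail] <;> ring

theorem exists_action_o2Heis3 (hK : K ≠ 0) (hb : b ≠ 0) :
    ∃ Φ : O2Heis3 →ₗ[ℝ] ((Fin 4 → ℝ) → (Fin 4 → ℝ)),
      IsTransitiveKillingActionOnLevels (abcMetric K 0 b c) (abcDomain 0 b c)
        (fun p => p 0) Φ := by
  refine ⟨_, isTransitiveKillingActionOnLevels hK (o2Heis3Param K b) (fun ξ hξ => ?_)
    (fun v => ?_) o2Heis3Param_lie⟩
  · obtain ⟨⟨x, z⟩, A⟩ := ξ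
    rw [o2Heis3Param_apply] at hξ
    have h0 : x 0 = 0 := congrFun hξ 0
    have h1 : x 1 = 0 := congrFun hξ 1
    have h2 : A.1 1 0 = 0 := neg_eq_zero.1 (congrFun hξ 2)
    have h3 : z = 0 := by simpa [hK, hb] using congrFun hξ 3
    have hA : A = 0 := by
      apply Subtype.ext
      rw [so_two_eq A, h2]
      ext i j
      fin_cases i <;> fin_cases j <;> simp
    have hx : x = 0 := by
      ext k
      fin_cases k
      exacts [h0, h1]
    rw [hA, hx, h3]
    rfl
  · refine ⟨⟨⟨![v 0, v 1], v 3 / (2 * K * b)⟩, ⟨!![0, v 2; -v 2, 0], ?_⟩⟩, ?_⟩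
    · rw [LieAlgebra.Orthogonal.mem_so]
      ext i j
      fin_cases i <;> fin_cases j <;> simp
    · ext k
      fin_cases k <;> simp [o2Heis3Param_apply]
      field_simp

section Unitary

variable {J : Matrix (Fin 2) (Fin 2) ℂ} {ε : ℝ}

/-- The entries of a matrix in `𝔲(2)` (`ε = 1`) or `𝔲(1,1)` (`ε = -1`). -/
theorem skewHermitian_entries (hJ : J = Matrix.diagonal ![1, (ε : ℂ)]) (hε : ε ^ 2 = 1)
    (M : skewHermitianLie J) :
    (M.1 0 0).re = 0 ∧ (M.1 1 1).re = 0 ∧ (M.1 1 0).re = -ε * (M.1 0 1).re ∧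
      (M.1 1 0).im = ε * (M.1 0 1).im := by
  have hM := mem_skewHermitianLie.1 M.2
  generalize M.1 = A at hM ⊢
  rw [hJ] at hM
  have hε0 : ε ≠ 0 := by rintro rfl; norm_num at hε
  have h00 := congrArg Complex.re (congrFun (congrFun hM 0) 0)
  have h11 := congrArg Complex.re (congrFun (congrFun hM 1) 1)
  have h01 := congrFun (congrFun hM 0) 1
  have h01r := congrArg Complex.re h01
  have h01i := congrArg Complex.im h01
  simp [Matrix.mul_apply, Matrix.diagonal_apply] at h00 h11 h01r h01i
  refine ⟨by linarith, ?_, ?_, ?_⟩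
  · apply mul_left_cancel₀ hε0
    linarith
  · linear_combination ε * h01r - (A 1 0).re * hε
  · linear_combination -ε * h01i - (A 1 0).im * hε

variable (K a b J) in
/-- The isomorphism of `𝔲(2)` or `𝔲(1,1)` with the Lie algebra of the parameters of `killingField`,
for `a s² = ±2`. The off-diagonal entry moves the point `ζ = 0`, and the diagonal entries give a
rotation of the base surface and a translation along the fibres; the multiple of `K b / a`
appears because the values of `killingBracket` satisfy `δ = -(K b / a) γ`. -/
def unitaryParam (s : ℝ) : skewHermitianLie J →ₗ[ℝ] (Fin 4 → ℝ) where
  toFun M := ![-(s * (M.1 0 1).re), -(s * (M.1 0 1).im), (M.1 1 1).im - (M.1 0 0).im,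
    ((M.1 0 0).im - (M.1 1 1).im) * (K * b / a) + ((M.1 0 0).im + (M.1 1 1).im)]
  map_add' M N := by
    ext k
    fin_cases k <;> simp <;> ring
  map_smul' r M := by
    ext k
    fin_cases k <;> simp <;> ring

theorem unitaryParam_apply (s : ℝ) (M : skewHermitianLie J) : unitaryParam K a b J s M
    = ![-(s * (M.1 0 1).re), -(s * (M.1 0 1).im), (M.1 1 1).im - (M.1 0 0).im,
      ((M.1 0 0).im - (M.1 1 1).im) * (K * b / a) + ((M.1 0 0).im + (M.1 1 1).im)] := rfl

theorem unitaryParam_lie (hJ : J = Matrix.diagonal ![1, (ε : ℂ)]) (hε : ε ^ 2 = 1) (ha : a ≠ 0)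
    {s : ℝ} (hs : a * s ^ 2 = 2 * ε) (M N : skewHermitianLie J) :
    unitaryParam K a b J s ⁅M, N⁆
      = killingBracket K a b (unitaryParam K a b J s M) (unitaryParam K a b J s N) := by
  obtain ⟨m0, m1, m2, m3⟩ := skewHermitian_entries hJ hε M
  obtain ⟨n0, n1, n2, n3⟩ := skewHermitian_entries hJ hε N
  simp only [unitaryParam_apply, LieSubalgebra.coe_bracket, LieRing.of_associative_ring_bracket,
    Matrix.sub_apply, Matrix.mul_apply, Fin.sum_univ_two, Complex.sub_re, Complex.sub_im,
    Complex.add_re, Complex.add_im, Complex.mul_re, Complex.mul_im, m0, m1, m2, m3, n0, n1, n2, n3,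
    killingBracket]
  have hs' : s ^ 2 = 2 * ε / a := by field_simp; linarith
  ext k
  fin_cases k
  · simp
    ring
  · simp
    ring
  · simp
    linear_combination (2 * ((M.1 0 1).re * (N.1 0 1).im - (M.1 0 1).im * (N.1 0 1).re)) * hs
  · simp
    linear_combination
      (-2 * K * b * ((M.1 0 1).re * (N.1 0 1).im - (M.1 0 1).im * (N.1 0 1).re)) * hs'

theorem exists_action_skewHermitian (hK : K ≠ 0) (ha : a ≠ 0)
    (hJ : J = Matrix.diagonal ![1, (ε : ℂ)]) (hε : ε ^ 2 = 1) (haε : 0 < a * ε) :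
    ∃ Φ : skewHermitianLie J →ₗ[ℝ] ((Fin 4 → ℝ) → (Fin 4 → ℝ)),
      IsTransitiveKillingActionOnLevels (abcMetric K a b c) (abcDomain a b c)
        (fun p => p 0) Φ := by
  have hpos : 0 < 2 / (a * ε) := by positivity
  have hε0 : ε ≠ 0 := by rintro rfl; norm_num at hε
  obtain ⟨s, hs0, hs⟩ : ∃ s : ℝ, s ≠ 0 ∧ a * s ^ 2 = 2 * ε := by
    refine ⟨√(2 / (a * ε)), (Real.sqrt_pos.2 hpos).ne', ?_⟩
    rw [Real.sq_sqrt hpos.le]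
    field_simp
    exact hε.symm
  refine ⟨_, isTransitiveKillingActionOnLevels hK (unitaryParam K a b J s) (fun M hM => ?_)
    (fun v => ?_) (unitaryParam_lie hJ hε ha hs)⟩
  · obtain ⟨m0, m1, m2, m3⟩ := skewHermitian_entries hJ hε M
    rw [unitaryParam_apply] at hM
    have h0 : (M.1 0 1).re = 0 := by simpa [hs0] using congrFun hM 0
    have h1 : (M.1 0 1).im = 0 := by simpa [hs0] using congrFun hM 1
    have h2 : (M.1 1 1).im - (M.1 0 0).im = 0 := congrFun hM 2
    have h3 : ((M.1 0 0).im - (M.1 1 1).im) * (K * b / a) + ((M.1 0 0).im + (M.1 1 1).im) = 0 :=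
      congrFun hM 3
    have h3' : (M.1 0 0).im + (M.1 1 1).im = 0 := by linear_combination h3 + K * b / a * h2
    rw [h0, mul_zero] at m2
    rw [h1, mul_zero] at m3
    apply Subtype.ext
    ext i j
    fin_cases i <;> fin_cases j
    · exact Complex.ext m0 (by simp; linarith)
    · exact Complex.ext h0 h1
    · exact Complex.ext m2 m3
    · exact Complex.ext m1 (by simp; linarith)
  · have hmem : !![(⟨0, (v 3 + v 2 * (K * b / a) - v 2) / 2⟩ : ℂ), ⟨-v 0 / s, -v 1 / s⟩;
        ⟨ε * v 0 / s, -ε * v 1 / s⟩, ⟨0, (v 3 + v 2 * (K * b / a) + v 2) / 2⟩]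
          ∈ skewHermitianLie J := by
      rw [mem_skewHermitianLie, hJ]
      ext i j
      fin_cases i <;> fin_cases j <;> apply Complex.ext <;>
        simp [Matrix.mul_apply, Matrix.diagonal_apply] <;>
        first
        | ring1
        | linear_combination (v 0 / s) * hε
        | linear_combination -(v 0 / s) * hε
        | linear_combination (v 1 / s) * hε
        | linear_combination -(v 1 / s) * hε
    refine ⟨⟨_, hmem⟩, ?_⟩
    ext k
    fin_cases k <;> simp [unitaryParam_apply] <;> first | ring1 | field_simp

end Unitary

end LieAlgebras

end AbcMetric

end

theorem proposition6p4 (K a b c : ℝ) (hK : K ≠ 0) :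
    (b * c * (b ^ 2 - 4 * a * c) = 0 →
      CoordGeom.IsLocallySymmetricOn (abcMetric K a b c) (abcDomain a b c)) ∧
    (b * c * (b ^ 2 - 4 * a * c) ≠ 0 →
      (∀ p ∈ abcDomain a b c,
        CoordGeom.cohomogeneityAt (abcMetric K a b c) (abcDomain a b c) p = 1) ∧
      (a = 0 → ∃ Φ : O2Heis3 →ₗ[ℝ] ((Fin 4 → ℝ) → (Fin 4 → ℝ)),
        CoordGeom.IsTransitiveKillingActionOnLevels (abcMetric K a b c) (abcDomain a b c)
          (fun p => p 0) Φ) ∧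
      (0 < a → ∃ Φ : u2 →ₗ[ℝ] ((Fin 4 → ℝ) → (Fin 4 → ℝ)),
        CoordGeom.IsTransitiveKillingActionOnLevels (abcMetric K a b c) (abcDomain a b c)
          (fun p => p 0) Φ) ∧
      (a < 0 → ∃ Φ : u11 →ₗ[ℝ] ((Fin 4 → ℝ) → (Fin 4 → ℝ)),
        CoordGeom.IsTransitiveKillingActionOnLevels (abcMetric K a b c) (abcDomain a b c)
          (fun p => p 0) Φ)) := by
  refine ⟨AbcMetric.isLocallySymmetricOn_abcMetric hK, fun habc =>
    ⟨fun p hp => AbcMetric.cohomogeneityAt_abcMetric hK habc hp, ?_, fun ha => ?_, fun ha => ?_⟩⟩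
  · rintro rfl
    exact AbcMetric.exists_action_o2Heis3 hK (left_ne_zero_of_mul (left_ne_zero_of_mul habc))
  · refine AbcMetric.exists_action_skewHermitian (ε := 1) hK ha.ne' ?_ (one_pow 2) (by simpa)
    ext i j
    fin_cases i <;> fin_cases j <;> simp
  · refine AbcMetric.exists_action_skewHermitian (ε := -1) hK ha.ne ?_ (by norm_num) (by simpa)
    simp
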